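/- Let $(Y,Z,W)$ be a random element of $\mathbb R\times\mathbb R^{d_z}\times\mathbb R^{d_w}$ satisfying the nonparametric instrumental regression model $$Y=\varphi(Z)+U,\qquad \mathbb E[U\mid W]=0,$$ with $U$ integrable and $\varphi\in L^2_Z=\{\phi:\mathbb E|\phi(Z)|^2<\infty\}$, and let $(Y_i,Z_i,W_i)_{i\ge1}$ be i.i.d. copies of $(Y,Z,W)$. Let $W$ have a Lebesgue density $p_W$ and (topological) support $\mathcal W$, let $\nu$ be a probability density on $\mathbb R^{d_w}$ that is strictly positive on $\mathcal W$, and let $(f_l)_{l\ge1}$ be an orthonormal basis of $L^2_\nu(\mathbb R^{d_w})=\{\phi:\int\phi^2(s)\nu(s)\,ds<\infty\}$. Let $\tau=(\tau_j)_{j\ge1}$ be a real sequence. Assume: (A1) there are constants $\eta_f,\eta_p\ge1$ with $\sup_{l\ge1}\int|f_l(s)|^4\nu(s)\,ds\le\eta_f$ and $\sup_{w\in\mathcal W}p_W(w)/\nu(w)\le\eta_p$; (A2) there is a constant $\sigma>0$ with $\mathbb E[U^4\mid W]\le\sigma^4$ almost surely (in particular $\mathbb E[U^4]<\infty$); (A3)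 the conditional expectation operator $T:L^2_Z\to L^2_W$, $T\phi=\mathbb E[\phi(Z)\mid W]$, is nonsingular, i.e. $T\phi=0$ implies $\phi=0$ in $L^2_Z$; (A4) $\tau$ is positive and nonincreasing with $\tau_1=1$. For $m\ge1$ and $1\le j,l\le m$ put $s_{jl}=\mathbb E\big[U^2\sqrt{\tau_j}f_j(W)\sqrt{\tau_l}f_l(W)\big]$, $\mu_m=\sum_{j=1}^m s_{jj}$ and $\varsigma_m=\big(\sum_{j,l=1}^m s_{jl}^2\big)^{1/2}$. Let $(m_n)_{n\ge1}$ be a sequence of nonnegative integers (empty sums being $0$) such that, as $n\to\infty$, $$\varsigma_{m_n}\to\infty\qquad\text{and}\qquad\Big(\sum_{j=1}^{m_n}\tau_j\Big)^3=o(n).$$ For a given function $\varphi_0$ let $$S_n=\sum_{j=1}^{m_n}\tau_j\Big|\frac1n\sum_{i=1}^n\big(Y_i-\varphi_0(Z_i)\big)f_j(W_i)\Big|^2 .$$ Then, under $H_0:\varphi=\varphi_0$ (as elements of $L^2_Z$), one has $$(\sqrt2\,\varsigma_{m_n})^{-1}\big(nS_n-\mu_{m_n}\big)\xrightarrow{d}\mathcal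 N(0,1)\qquad\text{as }n\to\infty.$$ -/

import Mathlib

open MeasureTheory ProbabilityTheory Filter Topology Asymptotics

noncomputable section

namespace NPIV

/-- `ℝᵈ`. -/
abbrev Vec (d : ℕ) : Type := EuclideanSpace ℝ (Fin d)

/-- The measure `p(s) ds` on `ℝᵈ`. -/
def densityMeasure {d : ℕ} (p : Vec d → ℝ) : Measure (Vec d) :=
  volume.withDensity fun s => ENNReal.ofReal (p s)

/-- `p` is a (Lebesgue) probability density function on `ℝᵈ`. -/
structure IsProbDensity {d : ℕ} (p : Vec d → ℝ) : Prop where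
  measurable : Measurable p
  nonneg : ∀ s, 0 ≤ p s
  lintegral_eq_one : ∫⁻ s, ENNReal.ofReal (p s) = 1

/-- The functions `f 0, f 1, …` form an orthonormal basis of `L²_ν(ℝᵈ)`. The sequence is indexed
from `0`, so `f j` is the `(j+1)`-st basis function. -/
def IsOrthonormalBasisOf {d : ℕ} (f : ℕ → Vec d → ℝ) (ν : Vec d → ℝ) : Prop :=
  ∃ b : HilbertBasis ℕ ℝ (Lp ℝ 2 (densityMeasure ν)),
    ∀ j, (b j : Vec d → ℝ) =ᵐ[densityMeasure ν] f j

variable {Ω : Type*} [MeasurableSpace Ω]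

/-- The conditional expectation given the random vector `W`, as a random variable. -/
def condExpGiven {d : ℕ} (P : Measure Ω) (W : Ω → Vec d) (X : Ω → ℝ) : Ω → ℝ :=
  P[X | MeasurableSpace.comap W inferInstance]

/-- The conditional expectation operator `(T φ)(w) = E[φ(Z) | W = w]`. -/
def condOp {dz dw : ℕ} (P : Measure Ω) [IsFiniteMeasure P] (Z : Ω → Vec dz) (W : Ω → Vec dw)
    (φ : Vec dz → ℝ) : Vec dw → ℝ :=
  fun w => ∫ z, φ z ∂(condDistrib Z W P w)

/-- `T : L²_Z → L²_W` is nonsingular: its null space is trivial. -/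
def NonsingularCondOp {dz dw : ℕ} (P : Measure Ω) [IsFiniteMeasure P] (Z : Ω → Vec dz)
    (W : Ω → Vec dw) : Prop :=
  ∀ φ : Vec dz → ℝ, MemLp φ 2 (P.map Z) → condOp P Z W φ =ᵐ[P.map W] 0 → φ =ᵐ[P.map Z] 0

/-- The nonparametric instrumental regression model `Y = φ(Z) + U`, `E[U | W] = 0`, with
structural function `φ ∈ L²_Z`. -/
structure IVModel {dz dw : ℕ} (P : Measure Ω) (Y : Ω → ℝ) (Z : Ω → Vec dz) (W : Ω → Vec dw)
    (φ : Vec dz → ℝ) (U : Ω → ℝ) : Prop where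
  measurable_Y : Measurable Y
  measurable_Z : Measurable Z
  measurable_W : Measurable W
  memLp_structural : MemLp φ 2 (P.map Z)
  integrable_U : Integrable U P
  eq_add : ∀ᵐ ω ∂P, Y ω = φ (Z ω) + U ω
  condExp_U : condExpGiven P W U =ᵐ[P] 0

/-- `(Y₁,Z₁,W₁), (Y₂,Z₂,W₂), …` (indexed from `0`) are i.i.d. copies of `(Y,Z,W)`. -/
structure IsIIDSample {dz dw : ℕ} (P : Measure Ω) (Y : Ω → ℝ) (Z : Ω → Vec dz) (W : Ω → Vec dw)
    (Ys : ℕ → Ω → ℝ) (Zs : ℕ → Ω → Vec dz) (Ws : ℕ → Ω → Vec dw) : Prop where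
  indep : iIndepFun (fun i ω => (Ys i ω, Zs i ω, Ws i ω)) P
  identDistrib : ∀ i, IdentDistrib (fun ω => (Ys i ω, Zs i ω, Ws i ω))
    (fun ω => (Y ω, Z ω, W ω)) P P

/-- The standing conditions on `W`, its density `p_W`, the reference density `ν`, and the
approximating functions `f`: `ν` is strictly positive on the support of `W` and `f` is an
orthonormal basis of `L²_ν`. -/
structure BasisSetup {dw : ℕ} (P : Measure Ω) (W : Ω → Vec dw) (pW ν : Vec dw → ℝ)
    (f : ℕ → Vec dw → ℝ) : Prop where
  density_W : IsProbDensity pW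
  law_W : P.map W = densityMeasure pW
  density_ν : IsProbDensity ν
  pos_ν : ∀ w ∈ (P.map W).support, 0 < ν w
  basis : IsOrthonormalBasisOf f ν

/-- `sup_l ∫ |f_l|⁴ ν ≤ η_f` and `sup_{w ∈ supp W} p_W(w) / ν(w) ≤ η_p`. -/
def BasisDensityBounds {dw : ℕ} (P : Measure Ω) (W : Ω → Vec dw) (pW ν : Vec dw → ℝ)
    (f : ℕ → Vec dw → ℝ) : Prop :=
  ∃ ηf ηp : ℝ, 1 ≤ ηf ∧ 1 ≤ ηp ∧
    (∀ l, ∫⁻ s, ENNReal.ofReal (|f l s| ^ 4) ∂(densityMeasure ν) ≤ ENNReal.ofReal ηf) ∧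
    (∀ w ∈ (P.map W).support, pW w / ν w ≤ ηp)

/-- `E[U⁴ | W] ≤ σ⁴` for some constant `σ > 0`. -/
def CondFourthMomentBound {dw : ℕ} (P : Measure Ω) (W : Ω → Vec dw) (U : Ω → ℝ) : Prop :=
  ∃ σ : ℝ, 0 < σ ∧ Integrable (fun ω => U ω ^ 4) P ∧
    ∀ᵐ ω ∂P, condExpGiven P W (fun ω => U ω ^ 4) ω ≤ σ ^ 4

/-- The weights are positive, nonincreasing, and the first one is `1`. -/
structure IsWeightSequence (τ : ℕ → ℝ) : Prop where
  pos : ∀ j, 0 < τ j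
  antitone : Antitone τ
  first : τ 0 = 1

/-- `s_{jl} = E[U² f_j^τ(W) f_l^τ(W)]` with `f_j^τ = √τ_j f_j`. -/
def covEntry {dw : ℕ} (P : Measure Ω) (W : Ω → Vec dw) (U : Ω → ℝ) (f : ℕ → Vec dw → ℝ)
    (τ : ℕ → ℝ) (j l : ℕ) : ℝ :=
  ∫ ω, U ω ^ 2 * (√(τ j) * f j (W ω)) * (√(τ l) * f l (W ω)) ∂P

/-- `μ_m`, the trace of `Σ_m = (s_{jl})`. -/
def covTrace {dw : ℕ} (P : Measure Ω) (W : Ω → Vec dw) (U : Ω → ℝ) (f : ℕ → Vec dw → ℝ)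
    (τ : ℕ → ℝ) (m : ℕ) : ℝ :=
  ∑ j ∈ Finset.range m, covEntry P W U f τ j j

/-- `ς_m`, the Frobenius norm of `Σ_m = (s_{jl})`. -/
def covFrobenius {dw : ℕ} (P : Measure Ω) (W : Ω → Vec dw) (U : Ω → ℝ) (f : ℕ → Vec dw → ℝ)
    (τ : ℕ → ℝ) (m : ℕ) : ℝ :=
  √(∑ j ∈ Finset.range m, ∑ l ∈ Finset.range m, covEntry P W U f τ j l ^ 2)

/-- `S_n = ∑_{j ≤ m} τ_j |n⁻¹ ∑_{i ≤ n} (Y_i - φ₀(Z_i)) f_j(W_i)|²`. -/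
def testStat {dz dw : ℕ} (Ys : ℕ → Ω → ℝ) (Zs : ℕ → Ω → Vec dz) (Ws : ℕ → Ω → Vec dw)
    (φ₀ : Vec dz → ℝ) (f : ℕ → Vec dw → ℝ) (τ : ℕ → ℝ) (n m : ℕ) : Ω → ℝ :=
  fun ω => ∑ j ∈ Finset.range m,
    τ j * |(n : ℝ)⁻¹ * ∑ i ∈ Finset.range n, (Ys i ω - φ₀ (Zs i ω)) * f j (Ws i ω)| ^ 2

end NPIV

end

/-!
Write `X_i ∈ ℝᵐ` for the score vector `(√τ_j f_j(W_i) (Y_i - φ₀(Z_i)))_{j ≤ m}`, where `m = m_n`.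
Under the null hypothesis the `X_i` are i.i.d. and centred, with covariance operator
`S = (s_{jl})`, and

  `n Sₙ = n⁻¹ ‖X₁ + ⋯ + Xₙ‖² = n⁻¹ ∑ ‖X_i‖² + 2 n⁻¹ ∑_{i < k} ⟪X_i, X_k⟫`.

The diagonal sum has mean `μ_m` and a variance that is negligible. The cross sum `T_n` is a
degenerate U-statistic with kernel depending on `n`; it is a martingale with increments
`⟪A_k, X_k⟫`, where `A_k` is the `k`-th partial sum. Conditionally on the past, the increment has
mean zero and variance `Q(A_k) = ⟪S A_k, A_k⟫`.

The characteristic function of `T_n` is computed by telescoping over `k`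
(`norm_integral_cexp_add_inner_sub_le`). Since `X_k` is independent of `(A_k, T_k)`, one step
multiplies the characteristic function by `exp (-θ² k V / 2)`, with `V = tr S² = ς_m²`, up to an
error controlled by `θ² E|Q(A_k) - k V|`, `|θ|³ E|⟪A_k, X_k⟫|³` and `(θ² k V)²`. No martingale
limit theorem is needed, because here every single conditional variance is close to its mean: its variance satisfies a
recursion in `k` (`IsCentredIID.integral_covQuad_sub_sq_le`) and is of smaller order than `n² V²`
when `V → ∞` and `M = E‖X_i‖⁴` is `o(n)`. The third moments are bounded through the fourth moments
(`IsCentredIID.integral_inner_pow_four_le`). The outcome is an explicit bound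
(`IsCentredIID.norm_integral_cexp_norm_partialSum_sq_sub_le`) that involves only a bound `L` on
`S`, the trace `V`, and `M / n`. Lévy's theorem turns it into a central limit
theorem for triangular arrays (`tendstoInDistribution_norm_partialSum_sq`).

For the score vectors, `E[U⁴ | W] ≤ σ⁴` and `p_W ≤ η_p ν` bound `E[U² g(W)]` and `E[U⁴ g(W)]` by
multiples of `∫ g ν`. Orthonormality of `f` and `τ ≤ 1` then make `L` independent of `m`, and the
bound on `∫ f_l⁴ ν` gives `M = O((∑ τ_j)²) = O((∑ τ_j)³) = o(n)`.
-/

open MeasureTheory ProbabilityTheory Filter Topology Asymptotics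

set_option linter.unusedSectionVars false

noncomputable section

namespace NPIV

open scoped RealInnerProductSpace

/-! ### Integrating out an independent variable -/

lemma integral_comp_prodMk_of_indepFun {Ω β γ G : Type*} [MeasurableSpace Ω] {P : Measure Ω}
    [IsFiniteMeasure P] [MeasurableSpace β] [MeasurableSpace γ] [NormedAddCommGroup G]
    [NormedSpace ℝ G] {Y : Ω → β} {X : Ω → γ} (h : IndepFun Y X P)
    (hY : AEMeasurable Y P) (hX : AEMeasurable X P) {F : β × γ → G}
    (hF : AEStronglyMeasurable F ((P.map Y).prod (P.map X)))
    (hint : Integrable (fun ω => F (Y ω, X ω)) P) :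
    ∫ ω, F (Y ω, X ω) ∂P = ∫ ω, ∫ x, F (Y ω, x) ∂(P.map X) ∂P := by
  have hmap := h.map_prod_eq_prod_map_map hY hX
  have hF' : AEStronglyMeasurable F (P.map fun ω => (Y ω, X ω)) := hmap ▸ hF
  have hi : Integrable F ((P.map Y).prod (P.map X)) := by
    rw [← hmap]
    exact (integrable_map_measure hF' (hY.prodMk hX)).2 hint
  rw [← integral_map (φ := fun ω => (Y ω, X ω)) (hY.prodMk hX) hF', hmap, integral_prod _ hi,
    integral_map hY]
  exact hF.integral_prod_right'

/-! ### The covariance operator -/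

section CovarianceOperator

variable {E : Type*} [NormedAddCommGroup E] [InnerProductSpace ℝ E] [CompleteSpace E]
  [MeasurableSpace E] [BorelSpace E] {μ : Measure E}

lemma covarianceOperator_inner_nonneg (a : E) : 0 ≤ ⟪covarianceOperator μ a, a⟫ :=
  isPositive_covarianceOperator.2 a

lemma covarianceOperator_symm (a b : E) :
    ⟪covarianceOperator μ a, b⟫ = ⟪covarianceOperator μ b, a⟫ := by
  rw [real_inner_comm a]
  exact isPositive_covarianceOperator.1 a b

lemma covarianceOperator_inner_self (hμ : MemLp id 2 μ) (a : E) :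
    ⟪covarianceOperator μ a, a⟫ = ∫ x, ⟪a, x⟫ ^ 2 ∂μ := by
  rw [covarianceOperator_inner hμ]
  simp_rw [sq]

/-- A bound `L` on the quadratic form of the covariance operator `S` gives `S² ≤ L S`. -/
lemma norm_covarianceOperator_sq_le {L : ℝ}
    (hL : ∀ a : E, ⟪covarianceOperator μ a, a⟫ ≤ L * ‖a‖ ^ 2) (a : E) :
    ‖covarianceOperator μ a‖ ^ 2 ≤ L * ⟪covarianceOperator μ a, a⟫ := by
  set b := covarianceOperator μ a with hb
  -- the Cauchy–Schwarz inequality for the positive form `⟪S ·, ·⟫` at `a` and `S a`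
  have hcs : ⟪b, b⟫ ^ 2 ≤ ⟪b, a⟫ * ⟪covarianceOperator μ b, b⟫ := by
    have h := discrim_le_zero (a := ⟪covarianceOperator μ b, b⟫) (b := 2 * ⟪b, b⟫)
      (c := ⟪b, a⟫) fun x => by
        have h0 := covarianceOperator_inner_nonneg (μ := μ) (x • b + a)
        have h1 : ⟪covarianceOperator μ b, a⟫ = ⟪b, b⟫ := by rw [covarianceOperator_symm, ← hb]
        simp only [map_add, map_smul, inner_add_left, inner_add_right, inner_smul_left,
          inner_smul_right, ← hb, h1, conj_trivial] at h0
        linarith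
    rw [discrim] at h
    linarith
  have h2 := hL b
  rw [real_inner_self_eq_norm_sq] at hcs
  have h3 : 0 ≤ ⟪b, a⟫ := covarianceOperator_inner_nonneg a
  rcases eq_or_ne b 0 with h0 | h0
  · simp [h0]
  · have h4 : 0 < ‖b‖ ^ 2 := by positivity
    nlinarith [mul_le_mul_of_nonneg_left h2 h3]

end CovarianceOperator

/-! ### Moments of inner products of independent vectors -/

section Indep

variable {E : Type*} [NormedAddCommGroup E] [InnerProductSpace ℝ E] [CompleteSpace E]
  [SecondCountableTopology E] [MeasurableSpace E] [BorelSpace E] {μ : Measure E}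
  {Ω : Type*} [MeasurableSpace Ω] {P : Measure Ω} [IsProbabilityMeasure P]
  {A X : Ω → E} {T : Ω → ℝ}

lemma memLp_id_of_map {p : ENNReal} (hXm : AEMeasurable X P) (hX : P.map X = μ)
    (hμ : MemLp id p μ) : MemLp X p P := by
  subst hX
  exact (memLp_map_measure_iff aestronglyMeasurable_id hXm).1 hμ

lemma integrable_norm_pow_of_memLp_four {E' : Type*} [NormedAddCommGroup E'] {Y : Ω → E'}
    (hY : MemLp Y 4 P) : Integrable (fun ω => ‖Y ω‖ ^ 4) P := by
  simpa using hY.integrable_norm_pow (p := 4) (by norm_num)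

lemma memLp_two_of_four {E' : Type*} [NormedAddCommGroup E'] {Y : Ω → E'}
    (hY : MemLp Y 4 P) : MemLp Y 2 P := hY.mono_exponent (by norm_num)

lemma integrable_inner_pow (h : IndepFun A X P) (p : ℕ) (hp : p ≠ 0) (hA : MemLp A p P)
    (hX : MemLp X p P) : Integrable (fun ω => ⟪A ω, X ω⟫ ^ p) P := by
  have h1 : Integrable (fun ω => ‖A ω‖ ^ p * ‖X ω‖ ^ p) P := by
    have := (h.comp (measurable_norm.pow_const p) (measurable_norm.pow_const p)).integrable_mul
      (X := fun ω => ‖A ω‖ ^ p) (Y := fun ω => ‖X ω‖ ^ p)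
      (by simpa using hA.integrable_norm_pow hp) (by simpa using hX.integrable_norm_pow hp)
    exact this
  refine h1.mono' ((hA.1.inner hX.1).pow p) (ae_of_all _ fun ω => ?_)
  rw [norm_pow, ← mul_pow]
  gcongr
  exact norm_inner_le_norm _ _

lemma indepFun_fst (h : IndepFun (fun ω => (A ω, T ω)) X P) : IndepFun A X P :=
  h.comp (φ := Prod.fst) (ψ := id) measurable_fst measurable_id

/-- Weighted second moment of `⟪A, X⟫`: integrating out the independent `X` first turns the square
into the quadratic form of the covariance operator of `X`. -/
lemma integral_inner_sq_smul {G : Type*} [NormedAddCommGroup G] [NormedSpace ℝ G]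
    [CompleteSpace G] (h : IndepFun (fun ω => (A ω, T ω)) X P) (hA : MemLp A 2 P) (hT : AEMeasurable T P)
    (hXm : AEMeasurable X P) (hX : P.map X = μ) (hμ : MemLp id 2 μ) {g : ℝ → G}
    (hg : Continuous g) {C : ℝ} (hgC : ∀ t, ‖g t‖ ≤ C) :
    ∫ ω, ⟪A ω, X ω⟫ ^ 2 • g (T ω) ∂P = ∫ ω, ⟪covarianceOperator μ (A ω), A ω⟫ • g (T ω) ∂P := by
  have hX2 := memLp_id_of_map hXm hX hμ
  have hi : Integrable (fun ω => ⟪A ω, X ω⟫ ^ 2 • g (T ω)) P :=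
    (integrable_inner_pow (indepFun_fst h) 2 two_ne_zero hA hX2).smul_bdd C
      (hg.comp_aestronglyMeasurable hT.aestronglyMeasurable) (ae_of_all _ fun ω => hgC _)
  have := integral_comp_prodMk_of_indepFun h (hA.1.aemeasurable.prodMk hT) hXm
    (F := fun p : (E × ℝ) × E => ⟪p.1.1, p.2⟫ ^ 2 • g p.1.2)
    (Continuous.aestronglyMeasurable (by fun_prop)) hi
  rw [this, hX]
  refine integral_congr_ae (ae_of_all _ fun ω => ?_)
  simp only
  rw [integral_smul_const, covarianceOperator_inner_self hμ]

lemma integral_inner_smul {G : Type*} [NormedAddCommGroup G] [NormedSpace ℝ G]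
    [CompleteSpace G] (h : IndepFun (fun ω => (A ω, T ω)) X P) (hA : Integrable A P) (hT : AEMeasurable T P)
    (hXm : AEMeasurable X P) (hX : P.map X = μ) (hμ : MemLp id 2 μ) (hμ0 : ∫ x, x ∂μ = 0)
    {g : ℝ → G} (hg : Continuous g) {C : ℝ} (hgC : ∀ t, ‖g t‖ ≤ C) :
    ∫ ω, ⟪A ω, X ω⟫ • g (T ω) ∂P = 0 := by
  have hX2 := memLp_id_of_map hXm hX hμ
  have hμ1 : Integrable (fun x => x) μ := by
    have : IsProbabilityMeasure μ := hX ▸ Measure.isProbabilityMeasure_map hXm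
    exact hμ.integrable (by norm_num)
  have hi1 : Integrable (fun ω => ⟪A ω, X ω⟫) P := by
    simpa using integrable_inner_pow (indepFun_fst h) 1 one_ne_zero
      (by simpa using memLp_one_iff_integrable.2 hA) (hX2.mono_exponent (by norm_num))
  have hi : Integrable (fun ω => ⟪A ω, X ω⟫ • g (T ω)) P :=
    hi1.smul_bdd C (hg.comp_aestronglyMeasurable hT.aestronglyMeasurable)
      (ae_of_all _ fun ω => hgC _)
  have := integral_comp_prodMk_of_indepFun h (hA.1.aemeasurable.prodMk hT) hXm
    (F := fun p : (E × ℝ) × E => ⟪p.1.1, p.2⟫ • g p.1.2)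
    (Continuous.aestronglyMeasurable (by fun_prop)) hi
  rw [this, hX]
  refine (integral_congr_ae (ae_of_all _ fun ω => ?_)).trans (integral_zero _ _)
  simp only
  rw [integral_smul_const, integral_inner hμ1, hμ0, inner_zero_right, zero_smul]

lemma indepFun_prodMk_zero (h : IndepFun A X P) : IndepFun (fun ω => (A ω, (0 : ℝ))) X P :=
  h.comp (φ := fun a => (a, (0 : ℝ))) (ψ := id) (by fun_prop) measurable_id

lemma integral_inner_sq (h : IndepFun A X P) (hA : MemLp A 2 P)
    (hXm : AEMeasurable X P) (hX : P.map X = μ) (hμ : MemLp id 2 μ) :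
    ∫ ω, ⟪A ω, X ω⟫ ^ 2 ∂P = ∫ ω, ⟪covarianceOperator μ (A ω), A ω⟫ ∂P := by
  simpa using integral_inner_sq_smul (indepFun_prodMk_zero h) hA aemeasurable_const hXm hX hμ
    (g := fun _ => (1 : ℝ)) continuous_const (C := 1) (by simp)

lemma integral_inner_eq_zero (h : IndepFun A X P) (hA : Integrable A P)
    (hXm : AEMeasurable X P) (hX : P.map X = μ) (hμ : MemLp id 2 μ) (hμ0 : ∫ x, x ∂μ = 0) :
    ∫ ω, ⟪A ω, X ω⟫ ∂P = 0 := by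
  simpa using integral_inner_smul (indepFun_prodMk_zero h) hA aemeasurable_const hXm hX hμ hμ0
    (g := fun _ => (1 : ℝ)) continuous_const (C := 1) (by simp)

end Indep

section

/-! ### Partial sums of a centred i.i.d. sequence -/

section Deterministic

variable {E : Type*} [NormedAddCommGroup E] [InnerProductSpace ℝ E]

/-- `x 0 + ⋯ + x (k - 1)`. -/
def partialSum (x : ℕ → E) (k : ℕ) : E := ∑ i ∈ Finset.range k, x i

/-- `∑_{i < j < k} ⟪x i, x j⟫`, arranged by the larger index. -/
def crossSum (x : ℕ → E) (k : ℕ) : ℝ := ∑ j ∈ Finset.range k, ⟪partialSum x j, x j⟫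

@[simp] lemma partialSum_zero (x : ℕ → E) : partialSum x 0 = 0 := by simp [partialSum]

lemma partialSum_succ (x : ℕ → E) (k : ℕ) : partialSum x (k + 1) = partialSum x k + x k :=
  Finset.sum_range_succ _ _

@[simp] lemma crossSum_zero (x : ℕ → E) : crossSum x 0 = 0 := by simp [crossSum]

lemma crossSum_succ (x : ℕ → E) (k : ℕ) :
    crossSum x (k + 1) = crossSum x k + ⟪partialSum x k, x k⟫ :=
  Finset.sum_range_succ _ _

lemma norm_partialSum_sq (x : ℕ → E) (k : ℕ) :
    ‖partialSum x k‖ ^ 2 = ∑ i ∈ Finset.range k, ‖x i‖ ^ 2 + 2 * crossSum x k := by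
  induction k with
  | zero => simp
  | succ k ih =>
    rw [partialSum_succ, crossSum_succ, Finset.sum_range_succ, norm_add_sq_real, ih]
    ring

end Deterministic

variable {E : Type*} [NormedAddCommGroup E] [InnerProductSpace ℝ E] [CompleteSpace E]
  [SecondCountableTopology E] [MeasurableSpace E] [BorelSpace E] {μ : Measure E}
  {Ω : Type*} [MeasurableSpace Ω] {P : Measure Ω}

/-- `X 0, X 1, …` are i.i.d. random vectors with law `μ`, which is centred and has a fourth
moment. -/
structure IsCentredIID (P : Measure Ω) (X : ℕ → Ω → E) (μ : Measure E) : Prop where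
  aemeasurable : ∀ i, AEMeasurable (X i) P
  map_eq : ∀ i, P.map (X i) = μ
  indep : iIndepFun X P
  memLp : MemLp id 4 μ
  mean_eq_zero : ∫ x, x ∂μ = 0

namespace IsCentredIID

variable {X : ℕ → Ω → E} [IsProbabilityMeasure P]

lemma isProbabilityMeasure (h : IsCentredIID P X μ) : IsProbabilityMeasure μ :=
  h.map_eq 0 ▸ Measure.isProbabilityMeasure_map (h.aemeasurable 0)

lemma memLp_two (h : IsCentredIID P X μ) : MemLp id 2 μ :=
  have := h.isProbabilityMeasure
  memLp_two_of_four h.memLp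

lemma memLp_apply (h : IsCentredIID P X μ) (i : ℕ) : MemLp (X i) 4 P :=
  memLp_id_of_map (h.aemeasurable i) (h.map_eq i) h.memLp

lemma memLp_partialSum (h : IsCentredIID P X μ) (k : ℕ) :
    MemLp (fun ω => partialSum (fun i => X i ω) k) 4 P :=
  memLp_finsetSum _ fun i _ => h.memLp_apply i

lemma aemeasurable_partialSum (h : IsCentredIID P X μ) (k : ℕ) :
    AEMeasurable (fun ω => partialSum (fun i => X i ω) k) P :=
  (h.memLp_partialSum k).1.aemeasurable

lemma aemeasurable_crossSum (h : IsCentredIID P X μ) (k : ℕ) :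
    AEMeasurable (fun ω => crossSum (fun i => X i ω) k) P :=
  Finset.aemeasurable_fun_sum _ fun j _ =>
    (h.aemeasurable_partialSum j).inner (h.aemeasurable j)

/-- The partial sum and the cross sum of the first `k` terms are jointly independent of the next
term. -/
lemma indepFun_sums (h : IsCentredIID P X μ) (k : ℕ) :
    IndepFun (fun ω => (partialSum (fun i => X i ω) k, crossSum (fun i => X i ω) k)) (X k) P := by
  have h1 := h.indep.indepFun_finset₀ (Finset.range k) {k} (by simp) h.aemeasurable
  -- extend a tuple indexed by `Finset.range k` by zero to a sequence
  let e : (Finset.range k → E) → ℕ → E := fun y i => if hi : i ∈ Finset.range k then y ⟨i, hi⟩ else 0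
  have he : ∀ i, Measurable fun y => e y i := by
    intro i
    by_cases hi : i ∈ Finset.range k
    · simpa only [e, hi, dif_pos] using measurable_pi_apply _
    · simp only [e, hi, dif_neg, not_false_eq_true, measurable_const]
  have hp : ∀ j, Measurable fun y => partialSum (e y) j := fun j =>
    Finset.measurable_fun_sum _ fun i _ => he i
  have hc : Measurable fun y => crossSum (e y) k :=
    Finset.measurable_fun_sum _ fun j _ => (hp j).inner (he j)
  have h2 := h1.comp ((hp k).prodMk hc) (measurable_pi_apply (⟨k, by simp⟩ : ({k} : Finset ℕ)))
  have hpe : ∀ ω, ∀ j ≤ k, partialSum (e fun i : Finset.range k => X i ω) j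
      = partialSum (fun i => X i ω) j := fun ω j hj => by
    refine Finset.sum_congr rfl fun i hi => ?_
    have : i ∈ Finset.range k := Finset.mem_range.2 ((Finset.mem_range.1 hi).trans_le hj)
    simp only [e, this, dif_pos]
  have hce : ∀ ω, crossSum (e fun i : Finset.range k => X i ω) k
      = crossSum (fun i => X i ω) k := fun ω => by
    refine Finset.sum_congr rfl fun j hj => ?_
    rw [hpe ω j (Finset.mem_range.1 hj).le]
    simp only [e, hj, dif_pos]
  convert h2 using 1
  · funext ω
    simp only [Function.comp, hpe ω k le_rfl, hce ω]
  · rfl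

lemma indepFun_partialSum (h : IsCentredIID P X μ) (k : ℕ) :
    IndepFun (fun ω => partialSum (fun i => X i ω) k) (X k) P :=
  indepFun_fst (h.indepFun_sums k)

end IsCentredIID

/-! ### Fourth moments -/

section FourthMoment

variable [IsProbabilityMeasure P] {s z : Ω → ℝ}

lemma integrable_pow_of_memLp {s : Ω → ℝ} (n : ℕ) (hn : n ≠ 0) (hs : MemLp s n P) :
    Integrable (fun ω => s ω ^ n) P := by
  refine (integrable_norm_iff (hs.1.pow n)).1 ?_
  simpa using hs.integrable_norm_pow hn

lemma integral_add_pow_four_le (h : IndepFun s z P) (hs : MemLp s 4 P) (hz : MemLp z 4 P)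
    (hz0 : ∫ ω, z ω ∂P = 0) :
    ∫ ω, (s ω + z ω) ^ 4 ∂P
      ≤ ∫ ω, s ω ^ 4 ∂P + 8 * ((∫ ω, s ω ^ 2 ∂P) * ∫ ω, z ω ^ 2 ∂P) + 3 * ∫ ω, z ω ^ 4 ∂P := by
  have hs2 := integrable_pow_of_memLp 2 two_ne_zero (hs.mono_exponent (by norm_num))
  have hz2 := integrable_pow_of_memLp 2 two_ne_zero (hz.mono_exponent (by norm_num))
  have hs3 := integrable_pow_of_memLp 3 three_ne_zero (hs.mono_exponent (by norm_num))
  have hs4 := integrable_pow_of_memLp 4 four_ne_zero (hs.mono_exponent (by norm_num))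
  have hz4 := integrable_pow_of_memLp 4 four_ne_zero (hz.mono_exponent (by norm_num))
  have hz1 : Integrable z P := hz.integrable (by norm_num)
  have hsz4 := integrable_pow_of_memLp 4 four_ne_zero ((hs.add hz).mono_exponent (by norm_num))
  have i31 : IndepFun (fun ω => s ω ^ 3) z P :=
    h.comp (φ := fun x => x ^ 3) (ψ := id) (by fun_prop) measurable_id
  have i22 : IndepFun (fun ω => s ω ^ 2) (fun ω => z ω ^ 2) P :=
    h.comp (φ := fun x => x ^ 2) (ψ := fun x => x ^ 2) (by fun_prop) (by fun_prop)
  have hi31 : Integrable (fun ω => s ω ^ 3 * z ω) P := i31.integrable_mul hs3 hz1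
  have hi22 : Integrable (fun ω => s ω ^ 2 * z ω ^ 2) P := i22.integrable_mul hs2 hz2
  have e31 : ∫ ω, s ω ^ 3 * z ω ∂P = 0 := by
    rw [i31.integral_fun_mul_eq_mul_integral hs3.1 hz1.1, hz0, mul_zero]
  have e22 : ∫ ω, s ω ^ 2 * z ω ^ 2 ∂P = (∫ ω, s ω ^ 2 ∂P) * ∫ ω, z ω ^ 2 ∂P :=
    i22.integral_fun_mul_eq_mul_integral hs2.1 hz2.1
  calc ∫ ω, (s ω + z ω) ^ 4 ∂P
      ≤ ∫ ω, (s ω ^ 4 + 4 * (s ω ^ 3 * z ω) + 8 * (s ω ^ 2 * z ω ^ 2) + 3 * z ω ^ 4) ∂P := by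
        refine integral_mono hsz4 (((hs4.add (hi31.const_mul 4)).add (hi22.const_mul 8)).add
          (hz4.const_mul 3)) fun ω => ?_
        -- `4 s z³ ≤ 2 s² z² + 2 z⁴`
        change (s ω + z ω) ^ 4 ≤ _
        nlinarith [mul_nonneg (sq_nonneg (z ω)) (sq_nonneg (s ω - z ω))]
    _ = _ := by
        rw [integral_add, integral_add, integral_add, integral_const_mul, integral_const_mul,
          integral_const_mul, e31, e22]
        · ring
        all_goals fun_prop

lemma integral_add_sq_of_indepFun (h : IndepFun s z P) (hs : MemLp s 2 P) (hz : MemLp z 2 P)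
    (hz0 : ∫ ω, z ω ∂P = 0) :
    ∫ ω, (s ω + z ω) ^ 2 ∂P = ∫ ω, s ω ^ 2 ∂P + ∫ ω, z ω ^ 2 ∂P := by
  have hs1 : Integrable s P := hs.integrable (by norm_num)
  have hz1 : Integrable z P := hz.integrable (by norm_num)
  have hs2 := hs.integrable_sq
  have hz2 := hz.integrable_sq
  have hi : Integrable (fun ω => s ω * z ω) P := h.integrable_mul hs1 hz1
  have e : ∫ ω, s ω * z ω ∂P = 0 := by
    rw [h.integral_fun_mul_eq_mul_integral hs1.1 hz1.1, hz0, mul_zero]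
  calc ∫ ω, (s ω + z ω) ^ 2 ∂P = ∫ ω, (s ω ^ 2 + 2 * (s ω * z ω) + z ω ^ 2) ∂P := by
        congr 1; funext ω; ring
    _ = _ := by
        rw [integral_add, integral_add, integral_const_mul, e]
        · ring
        all_goals fun_prop

end FourthMoment

namespace IsCentredIID

variable {X : ℕ → Ω → E} [IsProbabilityMeasure P] {L : ℝ}

lemma memLp_inner_const {A : Ω → E} {p : ENNReal} (hA : MemLp A p P) (x : E) :
    MemLp (fun ω => ⟪A ω, x⟫) p P := by
  simpa only [real_inner_comm x] using hA.const_inner x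

lemma integral_inner_const_eq_zero (h : IsCentredIID P X μ) (i : ℕ) (x : E) :
    ∫ ω, ⟪X i ω, x⟫ ∂P = 0 := by
  have := h.isProbabilityMeasure
  have hi : Integrable (fun y => y) μ := h.memLp_two.integrable (by norm_num)
  rw [← integral_map (φ := X i) (f := fun y => ⟪y, x⟫) (h.aemeasurable i)
    (Continuous.aestronglyMeasurable (by fun_prop)), h.map_eq]
  simp_rw [real_inner_comm x]
  rw [integral_inner hi, h.mean_eq_zero, inner_zero_right]

lemma integral_inner_const_sq (h : IsCentredIID P X μ) (i : ℕ) (x : E) :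
    ∫ ω, ⟪X i ω, x⟫ ^ 2 ∂P = ⟪covarianceOperator μ x, x⟫ := by
  rw [← integral_map (φ := X i) (f := fun y => ⟪y, x⟫ ^ 2) (h.aemeasurable i)
    (Continuous.aestronglyMeasurable (by fun_prop)), h.map_eq,
    covarianceOperator_inner_self h.memLp_two]
  simp_rw [real_inner_comm x]

lemma integral_norm_pow_four (h : IsCentredIID P X μ) (i : ℕ) :
    ∫ ω, ‖X i ω‖ ^ 4 ∂P = ∫ x, ‖x‖ ^ 4 ∂μ := by
  rw [← integral_map (φ := X i) (f := fun y => ‖y‖ ^ 4) (h.aemeasurable i)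
    (Continuous.aestronglyMeasurable (by fun_prop)), h.map_eq]

lemma integral_inner_const_pow_four_le (h : IsCentredIID P X μ) (i : ℕ) (x : E) :
    ∫ ω, ⟪X i ω, x⟫ ^ 4 ∂P ≤ (∫ x, ‖x‖ ^ 4 ∂μ) * ‖x‖ ^ 4 := by
  rw [← h.integral_norm_pow_four i, ← integral_mul_const]
  refine integral_mono (integrable_pow_of_memLp 4 four_ne_zero
    (memLp_inner_const (h.memLp_apply i) x))
    ((integrable_norm_pow_of_memLp_four (h.memLp_apply i)).mul_const _) fun ω => ?_
  simp only
  rw [← mul_pow, ← (show Even 4 by decide).pow_abs]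
  gcongr
  exact abs_real_inner_le_norm _ _

lemma indepFun_inner_const (h : IsCentredIID P X μ) (k : ℕ) (x : E) :
    IndepFun (fun ω => ⟪partialSum (fun i => X i ω) k, x⟫) (fun ω => ⟪X k ω, x⟫) P :=
  (h.indepFun_partialSum k).comp (φ := fun a => ⟪a, x⟫) (ψ := fun a => ⟪a, x⟫)
    (by fun_prop) (by fun_prop)

lemma integral_inner_partialSum_const_sq_le (h : IsCentredIID P X μ)
    (hL : ∀ a : E, ⟪covarianceOperator μ a, a⟫ ≤ L * ‖a‖ ^ 2) (k : ℕ) (x : E) :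
    ∫ ω, ⟪partialSum (fun i => X i ω) k, x⟫ ^ 2 ∂P ≤ k * (L * ‖x‖ ^ 2) := by
  induction k with
  | zero => simp
  | succ k ih =>
    simp_rw [partialSum_succ, inner_add_left]
    rw [integral_add_sq_of_indepFun (h.indepFun_inner_const k x)
      (memLp_inner_const (memLp_two_of_four (h.memLp_partialSum k)) x)
      (memLp_inner_const (memLp_two_of_four (h.memLp_apply k)) x)
      (h.integral_inner_const_eq_zero k x), h.integral_inner_const_sq]
    push_cast
    linarith [hL x]

lemma integral_inner_partialSum_const_pow_four_le (h : IsCentredIID P X μ) (hL0 : 0 ≤ L)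
    (hL : ∀ a : E, ⟪covarianceOperator μ a, a⟫ ≤ L * ‖a‖ ^ 2) (k : ℕ) (x : E) :
    ∫ ω, ⟪partialSum (fun i => X i ω) k, x⟫ ^ 4 ∂P
      ≤ (4 * k ^ 2 * L ^ 2 + 3 * k * ∫ x, ‖x‖ ^ 4 ∂μ) * ‖x‖ ^ 4 := by
  induction k with
  | zero => simp
  | succ k ih =>
    simp_rw [partialSum_succ, inner_add_left]
    have h1 := integral_add_pow_four_le (h.indepFun_inner_const k x)
      (memLp_inner_const (h.memLp_partialSum k) x) (memLp_inner_const (h.memLp_apply k) x)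
      (h.integral_inner_const_eq_zero k x)
    rw [h.integral_inner_const_sq] at h1
    have h2 : (∫ ω, ⟪partialSum (fun i => X i ω) k, x⟫ ^ 2 ∂P) * ⟪covarianceOperator μ x, x⟫
        ≤ (k * (L * ‖x‖ ^ 2)) * (L * ‖x‖ ^ 2) :=
      mul_le_mul (h.integral_inner_partialSum_const_sq_le hL k x) (hL x)
        (covarianceOperator_inner_nonneg x) (by positivity)
    have h3 := h.integral_inner_const_pow_four_le k x
    have h4 : 0 ≤ L ^ 2 * ‖x‖ ^ 4 := by positivity
    push_cast
    nlinarith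

/-- The fourth moment of the increments of the cross sum: the terms of order `k²` come from the
Gaussian behaviour of `partialSum`, and the others are of lower order. -/
lemma integral_inner_pow_four_le (h : IsCentredIID P X μ) (hL0 : 0 ≤ L)
    (hL : ∀ a : E, ⟪covarianceOperator μ a, a⟫ ≤ L * ‖a‖ ^ 2) (k : ℕ) :
    ∫ ω, ⟪partialSum (fun i => X i ω) k, X k ω⟫ ^ 4 ∂P
      ≤ (4 * k ^ 2 * L ^ 2 + 3 * k * ∫ x, ‖x‖ ^ 4 ∂μ) * ∫ x, ‖x‖ ^ 4 ∂μ := by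
  have hA := h.aemeasurable_partialSum k
  have hi := integrable_inner_pow (h.indepFun_partialSum k) 4 four_ne_zero
    (h.memLp_partialSum k) (h.memLp_apply k)
  have hfub := integral_comp_prodMk_of_indepFun (h.indepFun_partialSum k).symm (h.aemeasurable k)
    hA (F := fun p : E × E => ⟪p.2, p.1⟫ ^ 4) (Continuous.aestronglyMeasurable (by fun_prop)) hi
  rw [hfub, ← h.integral_norm_pow_four k, ← integral_const_mul]
  refine integral_mono_of_nonneg
    (ae_of_all _ fun ω => integral_nonneg fun x => (show Even 4 by decide).pow_nonneg _)
    ((integrable_norm_pow_of_memLp_four (h.memLp_apply k)).const_mul _)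
    (ae_of_all _ fun ω => ?_)
  simp only
  rw [integral_map (f := fun y => ⟪y, X k ω⟫ ^ 4) hA
    (Continuous.aestronglyMeasurable (by fun_prop)), h.integral_norm_pow_four k]
  exact h.integral_inner_partialSum_const_pow_four_le hL0 hL k _

end IsCentredIID

end

section

variable {E : Type*} [NormedAddCommGroup E] [InnerProductSpace ℝ E] [CompleteSpace E]
  [SecondCountableTopology E] [MeasurableSpace E] [BorelSpace E] {μ : Measure E}
  {Ω : Type*} [MeasurableSpace Ω] {P : Measure Ω} [IsProbabilityMeasure P]

/-! ### Concentration of the conditional variances -/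

/-- The quadratic form `⟪S a, a⟫` of the covariance operator `S` of `μ`: the variance of `⟪a, x⟫`
when `x` has the centred law `μ`. -/
def covQuad (μ : Measure E) (a : E) : ℝ := ⟪covarianceOperator μ a, a⟫

lemma covQuad_nonneg (a : E) : 0 ≤ covQuad μ a := covarianceOperator_inner_nonneg a

lemma continuous_covQuad : Continuous (covQuad μ) := by
  unfold covQuad
  fun_prop

lemma covQuad_add (a b : E) :
    covQuad μ (a + b) = covQuad μ a + 2 * ⟪covarianceOperator μ a, b⟫ + covQuad μ b := by
  simp only [covQuad, map_add, inner_add_left, inner_add_right]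
  rw [covarianceOperator_symm b a]
  ring

@[simp] lemma covQuad_zero : covQuad μ (0 : E) = 0 := by simp [covQuad]

lemma memLp_norm_sq {A : Ω → E} (hA : MemLp A 4 P) : MemLp (fun ω => ‖A ω‖ ^ 2) 2 P := by
  refine (memLp_two_iff_integrable_sq (hA.1.norm.pow 2)).2 ?_
  refine (integrable_norm_pow_of_memLp_four hA).congr (ae_of_all _ fun ω => ?_)
  simp only [Pi.pow_apply]
  ring

lemma memLp_covQuad {L : ℝ} (hL : ∀ a : E, covQuad μ a ≤ L * ‖a‖ ^ 2) {A : Ω → E}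
    (hA : MemLp A 4 P) : MemLp (fun ω => covQuad μ (A ω)) 2 P := by
  refine ((memLp_norm_sq hA).const_mul L).mono
    (continuous_covQuad.comp_aestronglyMeasurable hA.1) (ae_of_all _ fun ω => ?_)
  rw [Real.norm_of_nonneg (covQuad_nonneg _)]
  exact (hL _).trans (le_abs_self _)

lemma sq_integral_le_integral_sq {f : Ω → ℝ} (hf : MemLp f 2 P) :
    (∫ ω, f ω ∂P) ^ 2 ≤ ∫ ω, f ω ^ 2 ∂P := by
  have h := variance_nonneg f P
  rw [variance_eq_sub hf] at h
  simpa using h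

lemma integral_abs_le_sqrt {f : Ω → ℝ} (hf : MemLp f 2 P) :
    ∫ ω, |f ω| ∂P ≤ √(∫ ω, f ω ^ 2 ∂P) := by
  refine Real.le_sqrt_of_sq_le ?_
  simpa using sq_integral_le_integral_sq (P := P) hf.norm

lemma integral_sub_mean_sq_le {f : Ω → ℝ} (hf : MemLp f 2 P) {c : ℝ} (hc : ∫ ω, f ω ∂P = c) :
    ∫ ω, (f ω - c) ^ 2 ∂P ≤ ∫ ω, f ω ^ 2 ∂P := by
  have hi : Integrable f P := hf.integrable (by norm_num)
  have hi2 := hf.integrable_sq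
  have : ∫ ω, (f ω - c) ^ 2 ∂P = ∫ ω, (f ω ^ 2 - 2 * c * f ω + c ^ 2) ∂P := by
    congr 1; funext ω; ring
  rw [this, integral_add (by fun_prop) (by fun_prop), integral_sub (by fun_prop) (by fun_prop),
    integral_const_mul, hc]
  simp only [integral_const, probReal_univ, one_smul]
  nlinarith [sq_nonneg c]

namespace IsCentredIID

variable {X : ℕ → Ω → E} {L : ℝ}

lemma integral_covQuad (h : IsCentredIID P X μ) (i : ℕ) :
    ∫ ω, covQuad μ (X i ω) ∂P = ∫ x, covQuad μ x ∂μ := by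
  rw [← integral_map (φ := X i) (h.aemeasurable i)
    continuous_covQuad.aestronglyMeasurable, h.map_eq]

lemma integral_covQuad_nonneg : 0 ≤ ∫ x, covQuad μ x ∂μ := integral_nonneg covQuad_nonneg

lemma memLp_covarianceOperator (h : IsCentredIID P X μ) (k : ℕ) :
    MemLp (fun ω => covarianceOperator μ (partialSum (fun i => X i ω) k)) 4 P :=
  (covarianceOperator μ).comp_memLp' (h.memLp_partialSum k)

lemma indepFun_covarianceOperator (h : IsCentredIID P X μ) (k : ℕ) :
    IndepFun (fun ω => covarianceOperator μ (partialSum (fun i => X i ω) k)) (X k) P :=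
  (h.indepFun_partialSum k).comp (φ := covarianceOperator μ) (ψ := id) (by fun_prop) measurable_id

lemma integral_covQuad_partialSum (h : IsCentredIID P X μ)
    (hL : ∀ a : E, covQuad μ a ≤ L * ‖a‖ ^ 2) (k : ℕ) :
    ∫ ω, covQuad μ (partialSum (fun i => X i ω) k) ∂P = k * ∫ x, covQuad μ x ∂μ := by
  induction k with
  | zero => simp
  | succ k ih =>
    have h1 := integral_inner_eq_zero (h.indepFun_covarianceOperator k)
      ((h.memLp_covarianceOperator k).integrable (by norm_num))
      (h.aemeasurable k) (h.map_eq k) h.memLp_two h.mean_eq_zero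
    have i1 : Integrable (fun ω => ⟪covarianceOperator μ (partialSum (fun i => X i ω) k), X k ω⟫)
        P := by
      simpa using integrable_inner_pow (h.indepFun_covarianceOperator k) 1 one_ne_zero
        ((h.memLp_covarianceOperator k).mono_exponent (by norm_num))
        ((h.memLp_apply k).mono_exponent (by norm_num))
    have i2 := (memLp_covQuad hL (h.memLp_partialSum k)).integrable (by norm_num)
    have i3 := (memLp_covQuad hL (h.memLp_apply k)).integrable (by norm_num)
    simp_rw [partialSum_succ, covQuad_add]
    rw [integral_add (by fun_prop) (by fun_prop), integral_add (by fun_prop) (by fun_prop),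
      integral_const_mul, h1, ih, h.integral_covQuad]
    push_cast
    ring

lemma integral_inner_partialSum_sq (h : IsCentredIID P X μ)
    (hL : ∀ a : E, covQuad μ a ≤ L * ‖a‖ ^ 2) (k : ℕ) :
    ∫ ω, ⟪partialSum (fun i => X i ω) k, X k ω⟫ ^ 2 ∂P = k * ∫ x, covQuad μ x ∂μ := by
  rw [integral_inner_sq (h.indepFun_partialSum k) (memLp_two_of_four (h.memLp_partialSum k))
    (h.aemeasurable k) (h.map_eq k) h.memLp_two]
  exact h.integral_covQuad_partialSum hL k

lemma integral_inner_covarianceOperator_sq_le (h : IsCentredIID P X μ) (hL0 : 0 ≤ L)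
    (hL : ∀ a : E, covQuad μ a ≤ L * ‖a‖ ^ 2) (k : ℕ) :
    ∫ ω, ⟪covarianceOperator μ (partialSum (fun i => X i ω) k), X k ω⟫ ^ 2 ∂P
      ≤ L ^ 2 * (k * ∫ x, covQuad μ x ∂μ) := by
  rw [integral_inner_sq (h.indepFun_covarianceOperator k)
    (memLp_two_of_four (h.memLp_covarianceOperator k))
    (h.aemeasurable k) (h.map_eq k) h.memLp_two, ← h.integral_covQuad_partialSum hL k,
    ← integral_const_mul]
  refine integral_mono ((memLp_covQuad hL (h.memLp_covarianceOperator k)).integrable (by norm_num))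
    (((memLp_covQuad hL (h.memLp_partialSum k)).integrable (by norm_num)).const_mul _)
    fun ω => ?_
  refine (hL _).trans ?_
  have := norm_covarianceOperator_sq_le hL (partialSum (fun i => X i ω) k)
  calc _ ≤ L * (L * covQuad μ (partialSum (fun i => X i ω) k)) := by gcongr; exact this
    _ = _ := by ring

lemma integral_covQuad_sq_le (h : IsCentredIID P X μ)
    (hL : ∀ a : E, covQuad μ a ≤ L * ‖a‖ ^ 2) (i : ℕ) :
    ∫ ω, covQuad μ (X i ω) ^ 2 ∂P ≤ L ^ 2 * ∫ x, ‖x‖ ^ 4 ∂μ := by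
  rw [← h.integral_norm_pow_four i, ← integral_const_mul]
  refine integral_mono (memLp_covQuad hL (h.memLp_apply i)).integrable_sq
    ((integrable_norm_pow_of_memLp_four (h.memLp_apply i)).const_mul _) fun ω => ?_
  calc covQuad μ (X i ω) ^ 2 ≤ (L * ‖X i ω‖ ^ 2) ^ 2 := by
        gcongr
        · exact covQuad_nonneg _
        · exact hL _
    _ = _ := by ring

/-- The conditional variance `⟪S a, a⟫` of the `k`-th increment of the cross sum, `a` being the
partial sum, is close to its mean. -/
lemma integral_covQuad_sub_sq_le (h : IsCentredIID P X μ) (hL0 : 0 ≤ L)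
    (hL : ∀ a : E, covQuad μ a ≤ L * ‖a‖ ^ 2) (k : ℕ) :
    ∫ ω, (covQuad μ (partialSum (fun i => X i ω) k) - k * ∫ x, covQuad μ x ∂μ) ^ 2 ∂P
      ≤ 8 * k ^ 2 * L ^ 2 * (∫ x, covQuad μ x ∂μ) + 2 * k * L ^ 2 * ∫ x, ‖x‖ ^ 4 ∂μ := by
  induction k with
  | zero => simp
  | succ k ih =>
    set V := ∫ x, covQuad μ x ∂μ with hV
    set A : Ω → E := fun ω => partialSum (fun i => X i ω) k with hA
    let q : Ω → ℝ := fun ω => covQuad μ (A ω) - k * V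
    let d : Ω → ℝ := fun ω => ⟪covarianceOperator μ (A ω), X k ω⟫
    let r : Ω → ℝ := fun ω => covQuad μ (X k ω) - V
    have hV0 : 0 ≤ V := integral_covQuad_nonneg
    have hq : MemLp q 2 P := (memLp_covQuad hL (h.memLp_partialSum k)).sub (memLp_const _)
    have hr : MemLp r 2 P := (memLp_covQuad hL (h.memLp_apply k)).sub (memLp_const _)
    have hd2 : Integrable (fun ω => d ω ^ 2) P :=
      integrable_inner_pow (h.indepFun_covarianceOperator k) 2 two_ne_zero
        (memLp_two_of_four (h.memLp_covarianceOperator k)) (memLp_two_of_four (h.memLp_apply k))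
    have hd : MemLp d 2 P := (memLp_two_iff_integrable_sq
      ((h.memLp_covarianceOperator k).1.inner (h.memLp_apply k).1)).2 hd2
    have hqd : Integrable (fun ω => q ω * d ω) P := hq.integrable_mul hd
    have hqr : Integrable (fun ω => q ω * r ω) P := hq.integrable_mul hr
    -- both cross terms vanish since `X k` is centred and independent of the partial sum
    have eqd : ∫ ω, q ω * d ω ∂P = 0 := by
      have hind : IndepFun (fun ω => q ω • covarianceOperator μ (A ω)) (X k) P :=
        (h.indepFun_partialSum k).comp
          (φ := fun a => (covQuad μ a - k * V) • covarianceOperator μ a) (ψ := id)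
          (by
            have := continuous_covQuad (μ := μ)
            exact Continuous.measurable (by fun_prop)) measurable_id
      have hint : Integrable (fun ω => q ω • covarianceOperator μ (A ω)) P :=
        memLp_one_iff_integrable.1 ((memLp_two_of_four (h.memLp_covarianceOperator k)).smul hq)
      have := integral_inner_eq_zero hind hint (h.aemeasurable k) (h.map_eq k) h.memLp_two
        h.mean_eq_zero
      simpa only [real_inner_smul_left] using this
    have er : ∫ ω, r ω ∂P = 0 := by
      rw [integral_sub ((memLp_covQuad hL (h.memLp_apply k)).integrable (by norm_num))
        (integrable_const _), h.integral_covQuad]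
      simp [hV]
    have eqr : ∫ ω, q ω * r ω ∂P = 0 := by
      have hind : IndepFun q r P := (h.indepFun_partialSum k).comp
        (φ := fun a => covQuad μ a - k * V) (ψ := fun a => covQuad μ a - V)
        (continuous_covQuad.measurable.sub_const _) (continuous_covQuad.measurable.sub_const _)
      rw [hind.integral_fun_mul_eq_mul_integral hq.1 hr.1, er, mul_zero]
    have bd : ∫ ω, d ω ^ 2 ∂P ≤ L ^ 2 * (k * V) :=
      h.integral_inner_covarianceOperator_sq_le hL0 hL k
    have br : ∫ ω, r ω ^ 2 ∂P ≤ L ^ 2 * ∫ x, ‖x‖ ^ 4 ∂μ :=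
      (integral_sub_mean_sq_le (memLp_covQuad hL (h.memLp_apply k)) (h.integral_covQuad k)).trans
        (h.integral_covQuad_sq_le hL k)
    have hq2 := hq.integrable_sq
    have hr2 := hr.integrable_sq
    have hsum : MemLp (fun ω => q ω + 2 * d ω + r ω) 2 P := (hq.add (hd.const_mul 2)).add hr
    have key : ∫ ω, (q ω + 2 * d ω + r ω) ^ 2 ∂P
        ≤ ∫ ω, (q ω ^ 2 + 4 * (q ω * d ω) + 2 * (q ω * r ω) + 8 * d ω ^ 2 + 2 * r ω ^ 2) ∂P := by
      refine integral_mono hsum.integrable_sq (by fun_prop) fun ω => ?_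
      simp only
      nlinarith [sq_nonneg (2 * d ω - r ω)]
    rw [integral_add (by fun_prop) (by fun_prop), integral_add (by fun_prop) (by fun_prop),
      integral_add (by fun_prop) (by fun_prop), integral_add (by fun_prop) (by fun_prop),
      integral_const_mul, integral_const_mul, integral_const_mul, integral_const_mul, eqd,
      eqr] at key
    have hstep : ∀ ω, covQuad μ (partialSum (fun i => X i ω) (k + 1)) - ((k + 1 : ℕ) : ℝ) * V
        = q ω + 2 * d ω + r ω := fun ω => by
      simp only [partialSum_succ, covQuad_add, q, d, r, A]
      push_cast
      ring
    simp_rw [hstep]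
    have ih' : ∫ ω, q ω ^ 2 ∂P ≤ _ := ih
    have : 0 ≤ L ^ 2 * V := by positivity
    push_cast
    nlinarith

end IsCentredIID

/-! ### The characteristic function of the cross sum -/

section CharFun

open Complex

lemma norm_cexp_sub_taylor_two_le (y : ℝ) :
    ‖cexp (y * I) - 1 - y * I + y ^ 2 / 2‖ ≤ 4 * |y| ^ 3 := by
  rcases le_or_gt |y| 1 with hy | hy
  · have h := Complex.exp_bound (x := y * I) (by simpa using hy) (n := 3) (by norm_num)
    simp only [Finset.sum_range_succ, Finset.sum_range_zero] at h
    have e : cexp (y * I) - 1 - y * I + y ^ 2 / 2 = cexp (y * I) - (0 + (y * I) ^ 0 / (Nat.factorial 0 : ℕ)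
        + (y * I) ^ 1 / (Nat.factorial 1 : ℕ) + (y * I) ^ 2 / (Nat.factorial 2 : ℕ)) := by
      simp [mul_pow, Nat.factorial]
      ring
    rw [e]
    refine h.trans ?_
    simp only [norm_mul, norm_I, mul_one, norm_real, Real.norm_eq_abs]
    have : 0 ≤ |y| ^ 3 := by positivity
    norm_num [Nat.factorial]
    nlinarith
  · have h1 : ‖cexp (y * I)‖ = 1 := norm_exp_ofReal_mul_I y
    calc ‖cexp (y * I) - 1 - y * I + y ^ 2 / 2‖
        ≤ ‖cexp (y * I)‖ + ‖(1 : ℂ)‖ + ‖y * I‖ + ‖(y : ℂ) ^ 2 / 2‖ :=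
          (norm_add_le _ _).trans (add_le_add_left ((norm_sub_le _ _).trans
            (add_le_add_left (norm_sub_le _ _) _)) _)
      _ = 1 + 1 + |y| + |y| ^ 2 / 2 := by simp [h1]
      _ ≤ 4 * |y| ^ 3 := by nlinarith [mul_pos (sub_pos.2 hy) (sub_pos.2 hy), sq_nonneg |y|]

lemma abs_one_sub_sub_exp_neg_le {x : ℝ} (hx : 0 ≤ x) : |1 - x - Real.exp (-x)| ≤ x ^ 2 := by
  have h1 := Real.add_one_le_exp (-x)
  have h2 : Real.exp (-x) * (1 + x) ≤ 1 := by
    have := Real.add_one_le_exp x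
    calc Real.exp (-x) * (1 + x) ≤ Real.exp (-x) * Real.exp x := by
          gcongr; linarith
      _ = 1 := by rw [← Real.exp_add]; simp
  have h3 : Real.exp (-x) ≤ 1 - x + x ^ 2 := by
    have h4 : 1 ≤ (1 - x + x ^ 2) * (1 + x) := by nlinarith [pow_nonneg hx 3]
    have h5 : 0 < 1 + x := by linarith
    exact le_of_mul_le_mul_right (h2.trans h4) h5
  rw [abs_le]
  constructor <;> linarith

lemma norm_cexp_ofReal_mul_I_mul (θ t : ℝ) : ‖cexp (θ * t * I)‖ = 1 := by
  rw [← ofReal_mul]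
  exact norm_exp_ofReal_mul_I _

/-- One step of the telescoping: adding to `T` the increment `⟪A, X⟫` with an independent centred
`X` multiplies the characteristic function by nearly the Gaussian factor `exp (-θ² e / 2)`, if the
conditional variance `⟪S A, A⟫` is close to the constant `e`. -/
lemma norm_integral_cexp_add_inner_sub_le {A X : Ω → E} {T : Ω → ℝ}
    (h : IndepFun (fun ω => (A ω, T ω)) X P) (hA : MemLp A 4 P) (hT : AEMeasurable T P)
    (hXm : AEMeasurable X P) (hX : P.map X = μ) (hμ : MemLp id 4 μ) (hμ0 : ∫ x, x ∂μ = 0)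
    {L : ℝ} (hL : ∀ a : E, covQuad μ a ≤ L * ‖a‖ ^ 2) (θ : ℝ) {e : ℝ} (he : 0 ≤ e) :
    ‖∫ ω, cexp (θ * ↑(T ω + ⟪A ω, X ω⟫) * I) ∂P
        - Real.exp (-(θ ^ 2 * e / 2)) * ∫ ω, cexp (θ * T ω * I) ∂P‖
      ≤ θ ^ 2 / 2 * ∫ ω, |covQuad μ (A ω) - e| ∂P
        + 4 * |θ| ^ 3 * ∫ ω, |⟪A ω, X ω⟫| ^ 3 ∂P + (θ ^ 2 * e / 2) ^ 2 := by
  have hμp : IsProbabilityMeasure μ := hX ▸ Measure.isProbabilityMeasure_map hXm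
  have hμ2 : MemLp id 2 μ := memLp_two_of_four hμ
  have hA2 := memLp_two_of_four hA
  have hX4 := memLp_id_of_map hXm hX hμ
  have hX2 := memLp_two_of_four hX4
  have hind := indepFun_fst h
  set D : Ω → ℝ := fun ω => ⟪A ω, X ω⟫ with hD
  set Q : Ω → ℝ := fun ω => covQuad μ (A ω) with hQ
  set g : ℝ → ℂ := fun t => cexp (θ * t * I) with hg
  have hgc : Continuous g := by fun_prop
  have hgn : ∀ t, ‖g t‖ = 1 := fun t => norm_cexp_ofReal_mul_I_mul θ t
  have hgm : AEStronglyMeasurable (fun ω => g (T ω)) P :=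
    hgc.comp_aestronglyMeasurable hT.aestronglyMeasurable
  have hDm : AEStronglyMeasurable D P := hA.1.inner hX4.1
  have hD1 : Integrable D P := by
    simpa using integrable_inner_pow hind 1 one_ne_zero
      (hA2.mono_exponent (by norm_num)) (hX2.mono_exponent (by norm_num))
  have hD2 : Integrable (fun ω => D ω ^ 2) P := integrable_inner_pow hind 2 two_ne_zero hA2 hX2
  have hD3 : Integrable (fun ω => |D ω| ^ 3) P := by
    have := (integrable_inner_pow hind 3 three_ne_zero (hA.mono_exponent (by norm_num))
      (hX4.mono_exponent (by norm_num))).norm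
    simpa using this
  have hQ1 : Integrable Q P := (memLp_covQuad hL hA).integrable (by norm_num)
  have hQe : Integrable (fun ω => |Q ω - e|) P := (hQ1.sub (integrable_const e)).abs
  have e1 : ∫ ω, D ω • g (T ω) ∂P = 0 := integral_inner_smul h (hA2.integrable (by norm_num))
    hT hXm hX hμ2 hμ0 hgc (C := 1) fun t => (hgn t).le
  have e2 : ∫ ω, D ω ^ 2 • g (T ω) ∂P = ∫ ω, Q ω • g (T ω) ∂P :=
    integral_inner_sq_smul h hA2 hT hXm hX hμ2 hgc (C := 1) fun t => (hgn t).le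
  have i0 : Integrable (fun ω => g (T ω)) P :=
    Integrable.of_bound hgm 1 (ae_of_all _ fun ω => (hgn _).le)
  have ib : ∀ f : Ω → ℝ, Integrable f P → Integrable (fun ω => f ω • g (T ω)) P := fun f hf =>
    hf.smul_bdd 1 hgm (ae_of_all _ fun ω => (hgn _).le)
  have i1 := ib D hD1
  have i2 := ib _ hD2
  have i3 := ib Q hQ1
  have i4 : Integrable (fun ω => g (T ω + D ω)) P :=
    Integrable.of_bound (hgc.comp_aestronglyMeasurable (hT.aestronglyMeasurable.add hDm)) 1
      (ae_of_all _ fun ω => (hgn _).le)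
  set ρ : ℝ := Real.exp (-(θ ^ 2 * e / 2)) with hρ
  -- adding the two terms with vanishing total integral leaves only remainders
  have split : ∫ ω, g (T ω + D ω) ∂P - ρ * ∫ ω, g (T ω) ∂P
      = ∫ ω, (g (T ω + D ω) - ρ * g (T ω) - (θ * I) * (D ω • g (T ω))
          + (θ ^ 2 / 2 : ℂ) * (D ω ^ 2 • g (T ω) - Q ω • g (T ω))) ∂P := by
    have j0 : Integrable (fun ω => (ρ : ℂ) * g (T ω)) P := i0.const_mul _
    have j1 : Integrable (fun ω => (θ * I) * (D ω • g (T ω))) P := i1.const_mul _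
    have j2 : Integrable (fun ω => D ω ^ 2 • g (T ω) - Q ω • g (T ω)) P := i2.sub i3
    have j3 : Integrable
      (fun ω => (θ ^ 2 / 2 : ℂ) * (D ω ^ 2 • g (T ω) - Q ω • g (T ω))) P := j2.const_mul _
    have j4 : Integrable (fun ω => g (T ω + D ω) - ρ * g (T ω)) P := i4.sub j0
    have j5 : Integrable
      (fun ω => g (T ω + D ω) - ρ * g (T ω) - (θ * I) * (D ω • g (T ω))) P := j4.sub j1
    rw [integral_add j5 j3, integral_sub j4 j1, integral_sub i4 j0,
      integral_const_mul, integral_const_mul, integral_const_mul, integral_sub i2 i3, e1, e2]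
    simp
  have bound : ∀ ω, ‖g (T ω + D ω) - ρ * g (T ω) - (θ * I) * (D ω • g (T ω))
          + (θ ^ 2 / 2 : ℂ) * (D ω ^ 2 • g (T ω) - Q ω • g (T ω))‖
      ≤ θ ^ 2 / 2 * |Q ω - e| + 4 * |θ| ^ 3 * |D ω| ^ 3 + (θ ^ 2 * e / 2) ^ 2 := fun ω => by
    have hmul : g (T ω + D ω) = g (T ω) * cexp (↑(θ * D ω) * I) := by
      simp only [hg]
      rw [← Complex.exp_add]
      congr 1
      push_cast
      ring
    have hfac : g (T ω + D ω) - ρ * g (T ω) - (θ * I) * (D ω • g (T ω))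
          + (θ ^ 2 / 2 : ℂ) * (D ω ^ 2 • g (T ω) - Q ω • g (T ω))
        = g (T ω) * ((cexp (↑(θ * D ω) * I) - 1 - ↑(θ * D ω) * I + ↑(θ * D ω) ^ 2 / 2)
          + (-(θ ^ 2 / 2 * (Q ω - e)) : ℝ) + ((1 - θ ^ 2 * e / 2 - ρ : ℝ) : ℂ)) := by
      rw [hmul]
      simp only [real_smul]
      push_cast
      ring
    rw [hfac, norm_mul, hgn, one_mul]
    refine (norm_add₃_le).trans ?_
    have b1 := norm_cexp_sub_taylor_two_le (θ * D ω)
    have b2 : ‖((-(θ ^ 2 / 2 * (Q ω - e)) : ℝ) : ℂ)‖ = θ ^ 2 / 2 * |Q ω - e| := by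
      rw [norm_real, norm_neg, Real.norm_eq_abs, abs_mul, abs_of_nonneg (by positivity)]
    have b3 : ‖((1 - θ ^ 2 * e / 2 - ρ : ℝ) : ℂ)‖ ≤ (θ ^ 2 * e / 2) ^ 2 := by
      rw [norm_real, Real.norm_eq_abs]
      exact abs_one_sub_sub_exp_neg_le (by positivity)
    rw [abs_mul, mul_pow] at b1
    linarith
  have hgoal : ∀ ω, cexp (θ * ↑(T ω + ⟪A ω, X ω⟫) * I) = g (T ω + D ω) := fun ω => rfl
  simp_rw [hgoal]
  change ‖∫ ω, g (T ω + D ω) ∂P - ρ * ∫ ω, g (T ω) ∂P‖ ≤ _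
  rw [split]
  refine (norm_integral_le_integral_norm _).trans ?_
  calc _ ≤ ∫ ω, (θ ^ 2 / 2 * |Q ω - e| + 4 * |θ| ^ 3 * |D ω| ^ 3 + (θ ^ 2 * e / 2) ^ 2) ∂P :=
        integral_mono_of_nonneg (ae_of_all _ fun ω => norm_nonneg _)
          (((hQe.const_mul _).add (hD3.const_mul _)).add (integrable_const _))
          (ae_of_all _ bound)
    _ = _ := by
        rw [integral_add (by fun_prop) (by fun_prop),
          integral_add (by fun_prop) (by fun_prop), integral_const_mul,
          integral_const_mul]
        simp only [integral_const, probReal_univ, one_smul, Q, D]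

end CharFun

end

section

variable {E : Type*} [NormedAddCommGroup E] [InnerProductSpace ℝ E] [CompleteSpace E]
  [SecondCountableTopology E] [MeasurableSpace E] [BorelSpace E] {μ : Measure E}
  {Ω : Type*} [MeasurableSpace Ω] {P : Measure Ω} [IsProbabilityMeasure P]

/-! ### Gaussian approximation of the quadratic form -/

section GaussianApproximation

open Complex

lemma sq_integral_mul_le {f g : Ω → ℝ} (hf : MemLp f 2 P) (hg : MemLp g 2 P) :
    (∫ ω, f ω * g ω ∂P) ^ 2 ≤ (∫ ω, f ω ^ 2 ∂P) * ∫ ω, g ω ^ 2 ∂P := by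
  have hf2 := hf.integrable_sq
  have hg2 := hg.integrable_sq
  have hfg : Integrable (fun ω => f ω * g ω) P := hf.integrable_mul hg
  have h := discrim_le_zero (a := ∫ ω, f ω ^ 2 ∂P) (b := 2 * ∫ ω, f ω * g ω ∂P)
    (c := ∫ ω, g ω ^ 2 ∂P) fun x => by
      have h0 : 0 ≤ ∫ ω, (x * f ω + g ω) ^ 2 ∂P := integral_nonneg fun ω => sq_nonneg _
      have : ∫ ω, (x * f ω + g ω) ^ 2 ∂P
          = ∫ ω, (x * x * f ω ^ 2 + 2 * x * (f ω * g ω) + g ω ^ 2) ∂P := by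
        congr 1; funext ω; ring
      rw [this, integral_add (by fun_prop) (by fun_prop), integral_add (by fun_prop) (by fun_prop),
        integral_const_mul, integral_const_mul] at h0
      linarith
  rw [discrim] at h
  linarith

namespace IsCentredIID

variable {X : ℕ → Ω → E} {L : ℝ}

lemma integral_abs_inner_pow_three_le (h : IsCentredIID P X μ) (hL0 : 0 ≤ L)
    (hL : ∀ a : E, covQuad μ a ≤ L * ‖a‖ ^ 2) (k : ℕ) :
    ∫ ω, |⟪partialSum (fun i => X i ω) k, X k ω⟫| ^ 3 ∂P
      ≤ √(k * ∫ x, covQuad μ x ∂μ)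
        * √((4 * k ^ 2 * L ^ 2 + 3 * k * ∫ x, ‖x‖ ^ 4 ∂μ) * ∫ x, ‖x‖ ^ 4 ∂μ) := by
  set D : Ω → ℝ := fun ω => ⟪partialSum (fun i => X i ω) k, X k ω⟫
  have hDm : AEStronglyMeasurable D P := (h.memLp_partialSum k).1.inner (h.memLp_apply k).1
  have hD2 : Integrable (fun ω => D ω ^ 2) P := integrable_inner_pow (h.indepFun_partialSum k) 2
    two_ne_zero (memLp_two_of_four (h.memLp_partialSum k)) (memLp_two_of_four (h.memLp_apply k))
  have hD4 : Integrable (fun ω => D ω ^ 4) P := integrable_inner_pow (h.indepFun_partialSum k) 4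
    four_ne_zero (h.memLp_partialSum k) (h.memLp_apply k)
  have h1 : MemLp (fun ω => |D ω|) 2 P :=
    ((memLp_two_iff_integrable_sq hDm).2 hD2).norm
  have h2 : MemLp (fun ω => D ω ^ 2) 2 P := by
    refine (memLp_two_iff_integrable_sq (hDm.pow 2)).2 (hD4.congr (ae_of_all _ fun ω => ?_))
    simp only [Pi.pow_apply]
    ring
  have h3 := sq_integral_mul_le h1 h2
  have e1 : ∀ ω, |D ω| * D ω ^ 2 = |D ω| ^ 3 := fun ω => by rw [← sq_abs]; ring
  have e2 : ∀ ω, (D ω ^ 2) ^ 2 = D ω ^ 4 := fun ω => by ring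
  simp_rw [e1, e2, sq_abs] at h3
  have hb2 : ∫ ω, D ω ^ 2 ∂P = _ := h.integral_inner_partialSum_sq hL k
  have hb4 : ∫ ω, D ω ^ 4 ∂P ≤ _ := h.integral_inner_pow_four_le hL0 hL k
  have hV : 0 ≤ ∫ x, covQuad μ x ∂μ := integral_covQuad_nonneg
  rw [← Real.sqrt_mul (by positivity)]
  refine Real.le_sqrt_of_sq_le (h3.trans ?_)
  rw [hb2]
  gcongr

/-- The characteristic function of the cross sum at `θ` is close to that of a Gaussian whose
variance is the variance `V n (n - 1) / 2` of the cross sum. -/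
lemma norm_integral_cexp_crossSum_sub_le (h : IsCentredIID P X μ) (hL0 : 0 ≤ L)
    (hL : ∀ a : E, covQuad μ a ≤ L * ‖a‖ ^ 2) (θ : ℝ) {V M : ℝ}
    (hV : ∫ x, covQuad μ x ∂μ = V) (hM : ∫ x, ‖x‖ ^ 4 ∂μ = M) (n : ℕ) :
    ‖∫ ω, cexp (θ * crossSum (fun i => X i ω) n * I) ∂P
        - Real.exp (-(θ ^ 2 * V * (n * (n - 1)) / 4))‖
      ≤ n * (θ ^ 2 / 2 * √(8 * n ^ 2 * L ^ 2 * V + 2 * n * L ^ 2 * M)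
        + 4 * |θ| ^ 3 * (√(n * V) * √((4 * n ^ 2 * L ^ 2 + 3 * n * M) * M))
        + (θ ^ 2 * (n * V) / 2) ^ 2) := by
  have hV0 : 0 ≤ V := hV ▸ integral_covQuad_nonneg
  have hM0 : 0 ≤ M := hM ▸ integral_nonneg fun x => by positivity
  set B := θ ^ 2 / 2 * √(8 * n ^ 2 * L ^ 2 * V + 2 * n * L ^ 2 * M)
        + 4 * |θ| ^ 3 * (√(n * V) * √((4 * n ^ 2 * L ^ 2 + 3 * n * M) * M))
        + (θ ^ 2 * (n * V) / 2) ^ 2 with hB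
  suffices H : ∀ k : ℕ, k ≤ n → ‖∫ ω, cexp (θ * crossSum (fun i => X i ω) k * I) ∂P
      - Real.exp (-(θ ^ 2 * V * (k * (k - 1)) / 4))‖ ≤ k * B from H n le_rfl
  intro k
  induction k with
  | zero => intro _; simp
  | succ k ih =>
    intro hk
    have hkn : (k : ℝ) ≤ n := by exact_mod_cast (Nat.le_succ k).trans hk
    have step := norm_integral_cexp_add_inner_sub_le (h.indepFun_sums k) (h.memLp_partialSum k)
      (h.aemeasurable_crossSum k) (h.aemeasurable k) (h.map_eq k) h.memLp h.mean_eq_zero hL θ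
      (e := k * V) (by positivity)
    simp_rw [← crossSum_succ] at step
    have b1 : ∫ ω, |covQuad μ (partialSum (fun i => X i ω) k) - k * V| ∂P
        ≤ √(8 * n ^ 2 * L ^ 2 * V + 2 * n * L ^ 2 * M) := by
      have hm : MemLp (fun ω => covQuad μ (partialSum (fun i => X i ω) k) - k * V) 2 P :=
        (memLp_covQuad hL (h.memLp_partialSum k)).sub (memLp_const _)
      refine (integral_abs_le_sqrt hm).trans (Real.sqrt_le_sqrt ?_)
      have := h.integral_covQuad_sub_sq_le hL0 hL k
      rw [hV, hM] at this
      refine this.trans ?_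
      gcongr
    have b2 : ∫ ω, |⟪partialSum (fun i => X i ω) k, X k ω⟫| ^ 3 ∂P
        ≤ √(n * V) * √((4 * n ^ 2 * L ^ 2 + 3 * n * M) * M) := by
      have := h.integral_abs_inner_pow_three_le hL0 hL k
      rw [hV, hM] at this
      refine this.trans ?_
      gcongr
    have b3 : (θ ^ 2 * (k * V) / 2) ^ 2 ≤ (θ ^ 2 * (n * V) / 2) ^ 2 := by gcongr
    have stepB := step.trans (show _ ≤ B by rw [hB]; gcongr)
    have hexp : Real.exp (-(θ ^ 2 * V * (((k + 1 : ℕ) : ℝ) * (((k + 1 : ℕ) : ℝ) - 1)) / 4))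
        = Real.exp (-(θ ^ 2 * (k * V) / 2)) * Real.exp (-(θ ^ 2 * V * (k * (k - 1)) / 4)) := by
      rw [← Real.exp_add]
      congr 1
      push_cast
      ring
    rw [hexp]
    set c1 := ∫ ω, cexp (θ * crossSum (fun i => X i ω) (k + 1) * I) ∂P
    set c0 := ∫ ω, cexp (θ * crossSum (fun i => X i ω) k * I) ∂P
    set ρ := Real.exp (-(θ ^ 2 * (k * V) / 2)) with hρ
    set r := Real.exp (-(θ ^ 2 * V * (k * (k - 1)) / 4))
    have hρ1 : ‖(ρ : ℂ)‖ ≤ 1 := by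
      rw [norm_real, Real.norm_of_nonneg (Real.exp_pos _).le]
      exact Real.exp_le_one_iff.2 (neg_nonpos.2 (by positivity))
    have hih := ih ((Nat.le_succ k).trans hk)
    calc ‖c1 - ↑(ρ * r)‖ = ‖(c1 - ρ * c0) + ρ * (c0 - r)‖ := by
          congr 1; push_cast; ring
      _ ≤ ‖c1 - ρ * c0‖ + ‖(ρ : ℂ)‖ * ‖c0 - r‖ := (norm_add_le _ _).trans_eq (by rw [norm_mul])
      _ ≤ B + 1 * (k * B) := by gcongr
      _ = _ := by push_cast; ring

lemma integral_abs_sum_norm_sq_sub_le (h : IsCentredIID P X μ) (n : ℕ) :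
    ∫ ω, |∑ i ∈ Finset.range n, ‖X i ω‖ ^ 2 - n * ∫ x, ‖x‖ ^ 2 ∂μ| ∂P
      ≤ √(n * ∫ x, ‖x‖ ^ 4 ∂μ) := by
  have hm : ∀ i, MemLp (fun ω => ‖X i ω‖ ^ 2) 2 P := fun i => memLp_norm_sq (h.memLp_apply i)
  have hsum : MemLp (fun ω => ∑ i ∈ Finset.range n, ‖X i ω‖ ^ 2) 2 P :=
    memLp_finsetSum _ fun i _ => hm i
  have hmean : ∫ ω, ∑ i ∈ Finset.range n, ‖X i ω‖ ^ 2 ∂P = n * ∫ x, ‖x‖ ^ 2 ∂μ := by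
    rw [integral_finsetSum _ fun i _ => (hm i).integrable (by norm_num)]
    have : ∀ i, ∫ ω, ‖X i ω‖ ^ 2 ∂P = ∫ x, ‖x‖ ^ 2 ∂μ := fun i => by
      rw [← integral_map (φ := X i) (f := fun y => ‖y‖ ^ 2) (h.aemeasurable i)
        (Continuous.aestronglyMeasurable (by fun_prop)), h.map_eq]
    simp [this]
  refine (integral_abs_le_sqrt (hsum.sub (memLp_const _))).trans (Real.sqrt_le_sqrt ?_)
  have hvar := variance_eq_integral (X := fun ω => ∑ i ∈ Finset.range n, ‖X i ω‖ ^ 2)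
    (μ := P) hsum.1.aemeasurable
  rw [hmean] at hvar
  simp only [Pi.sub_apply]
  rw [← hvar]
  have hs : Var[fun ω => ∑ i ∈ Finset.range n, ‖X i ω‖ ^ 2; P]
      = ∑ i ∈ Finset.range n, Var[fun ω => ‖X i ω‖ ^ 2; P] := by
    have := IndepFun.variance_sum (X := fun i ω => ‖X i ω‖ ^ 2) (μ := P) (s := Finset.range n)
      (fun i _ => hm i) fun i _ j _ hij => (h.indep.indepFun hij).comp
        (φ := fun x => ‖x‖ ^ 2) (ψ := fun x => ‖x‖ ^ 2) (by fun_prop) (by fun_prop)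
    rw [← this]
    congr 1
    funext ω
    simp
  rw [hs]
  calc _ ≤ ∑ i ∈ Finset.range n, ∫ x, ‖x‖ ^ 4 ∂μ := by
        refine Finset.sum_le_sum fun i _ => ?_
        refine (variance_le_expectation_sq (hm i).1).trans_eq ?_
        rw [← h.integral_norm_pow_four i]
        congr 1
        funext ω
        simp only [Pi.pow_apply]
        ring
    _ = _ := by simp

/-- Quantitative normal approximation of `‖X 0 + ⋯ + X (n - 1)‖² / n`: for a fixed bound `L` on
the covariance operator, the error vanishes when `V → ∞` and the fourth moment `M` is `o(n)`. -/
lemma norm_integral_cexp_norm_partialSum_sq_sub_le (h : IsCentredIID P X μ) (hL0 : 0 ≤ L)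
    (hL : ∀ a : E, covQuad μ a ≤ L * ‖a‖ ^ 2) (t : ℝ) {V M : ℝ}
    (hV : ∫ x, covQuad μ x ∂μ = V) (hM : ∫ x, ‖x‖ ^ 4 ∂μ = M) (hV1 : 1 ≤ V) {n : ℕ} (hn : 0 < n) :
    ‖∫ ω, cexp (t * ↑((√2 * √V)⁻¹ *
          (‖partialSum (fun i => X i ω) n‖ ^ 2 / n - ∫ x, ‖x‖ ^ 2 ∂μ)) * I) ∂P
        - Real.exp (-(t ^ 2 * (1 - 1 / n) / 2))‖
      ≤ |t| * √(M / n) + (t ^ 2 * √(8 * L ^ 2 / V + 2 * L ^ 2 * (M / n))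
        + 12 * |t| ^ 3 * √(4 * L ^ 2 * (M / n) + 3 * (M / n) ^ 2) + t ^ 4 / n) := by
  have hn' : (0 : ℝ) < n := by exact_mod_cast hn
  have hV0 : 0 < V := by linarith
  have hM0 : 0 ≤ M := hM ▸ integral_nonneg fun x => by positivity
  have hsV : 0 < √V := Real.sqrt_pos.2 hV0
  have hsV2 : √V ^ 2 = V := Real.sq_sqrt hV0.le
  have hs2 : √2 ^ 2 = (2 : ℝ) := Real.sq_sqrt (by norm_num)
  have hs2' : 1 ≤ √2 := Real.one_le_sqrt.2 (by norm_num)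
  have hs20 : 0 < √2 := by positivity
  have hsV1 : 1 ≤ √V := Real.one_le_sqrt.2 hV1
  set m := ∫ x, ‖x‖ ^ 2 ∂μ with hm
  set θ : ℝ := t * (√2 / (n * √V)) with hθ
  let R : Ω → ℝ := fun ω => (√2 * √V * n)⁻¹ * (∑ i ∈ Finset.range n, ‖X i ω‖ ^ 2 - n * m)
  have hstat : ∀ ω, t * ((√2 * √V)⁻¹ * (‖partialSum (fun i => X i ω) n‖ ^ 2 / n - m))
      = θ * crossSum (fun i => X i ω) n + t * R ω := fun ω => by
    simp only [norm_partialSum_sq, R, hθ]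
    field_simp
    rw [hs2]
    ring
  have hθ2 : θ ^ 2 = 2 * t ^ 2 / (n ^ 2 * V) := by
    rw [hθ, mul_pow, div_pow, mul_pow, hs2, hsV2]
    ring
  have hcross := h.norm_integral_cexp_crossSum_sub_le hL0 hL θ hV hM n
  have hexp : θ ^ 2 * V * (n * (n - 1)) / 4 = t ^ 2 * (1 - 1 / n) / 2 := by
    rw [hθ2]
    field_simp
    ring
  rw [hexp] at hcross
  -- the diagonal terms contribute little
  have hdiag : ‖∫ ω, cexp (t * ↑((√2 * √V)⁻¹ *
          (‖partialSum (fun i => X i ω) n‖ ^ 2 / n - m)) * I) ∂P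
      - ∫ ω, cexp (θ * crossSum (fun i => X i ω) n * I) ∂P‖ ≤ |t| * √(M / n) := by
    have hTm := (h.aemeasurable_crossSum n).aestronglyMeasurable
    have hR2 : MemLp (fun ω => ∑ i ∈ Finset.range n, ‖X i ω‖ ^ 2 - n * m) 2 P :=
      (memLp_finsetSum _ fun i _ => memLp_norm_sq (h.memLp_apply i)).sub (memLp_const _)
    have hR1 : Integrable R P := (hR2.integrable (by norm_num)).const_mul _
    have hb : ∀ (f : Ω → ℝ), AEStronglyMeasurable f P →
        Integrable (fun ω => cexp (↑(f ω) * I)) P := fun f hf =>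
      Integrable.of_bound (Continuous.comp_aestronglyMeasurable
        (g := fun x : ℝ => cexp (x * I)) (by fun_prop) hf) 1
        (ae_of_all _ fun ω => (norm_exp_ofReal_mul_I _).le)
    have i1 := hb (fun ω => θ * crossSum (fun i => X i ω) n + t * R ω)
      ((hTm.const_mul θ).add (hR1.1.const_mul t))
    have i2 := hb _ (hTm.const_mul θ)
    have e1 : ∀ ω, cexp (t * ↑((√2 * √V)⁻¹ *
        (‖partialSum (fun i => X i ω) n‖ ^ 2 / n - m)) * I)
        = cexp (↑(θ * crossSum (fun i => X i ω) n + t * R ω) * I) := fun ω => by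
      rw [← ofReal_mul, hstat]
    simp_rw [e1, ← ofReal_mul θ]
    rw [← integral_sub i1 i2]
    refine (norm_integral_le_integral_norm _).trans ?_
    calc _ ≤ ∫ ω, |t| * |R ω| ∂P := by
          refine integral_mono_of_nonneg (ae_of_all _ fun ω => norm_nonneg _)
            (hR1.abs.const_mul _) (ae_of_all _ fun ω => ?_)
          have : cexp (↑(θ * crossSum (fun i => X i ω) n + t * R ω) * I)
              - cexp (↑(θ * crossSum (fun i => X i ω) n) * I)
              = cexp (↑(θ * crossSum (fun i => X i ω) n) * I) * (cexp (I * ↑(t * R ω)) - 1) := by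
            rw [mul_sub, ← Complex.exp_add, mul_one]
            congr 2
            push_cast
            ring
          simp only
          rw [this, norm_mul, norm_exp_ofReal_mul_I, one_mul, ← abs_mul]
          exact Real.norm_exp_I_mul_ofReal_sub_one_le
      _ = |t| * ((√2 * √V * n)⁻¹ *
            ∫ ω, |∑ i ∈ Finset.range n, ‖X i ω‖ ^ 2 - n * m| ∂P) := by
          have hRabs : ∀ ω, |R ω| = (√2 * √V * n)⁻¹ *
              |∑ i ∈ Finset.range n, ‖X i ω‖ ^ 2 - n * m| := fun ω => by
            simp only [R]
            rw [abs_mul, abs_of_nonneg (a := (√2 * √V * n)⁻¹) (by positivity)]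
          simp_rw [hRabs]
          rw [integral_const_mul, integral_const_mul]
      _ ≤ |t| * ((1 * 1 * (n : ℝ))⁻¹ * √(n * M)) := by
          have := h.integral_abs_sum_norm_sq_sub_le n
          rw [hM] at this
          gcongr
      _ = |t| * √(M / n) := by
          have : (n : ℝ) * M = n ^ 2 * (M / n) := by field_simp
          rw [this, Real.sqrt_mul (by positivity), Real.sqrt_sq hn'.le]
          field_simp
  refine (norm_sub_le_norm_sub_add_norm_sub _ _ _).trans (add_le_add hdiag (hcross.trans ?_))
  set κ := M / n with hκ
  have hκ0 : 0 ≤ κ := by positivity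
  have hMκ : M = n * κ := by rw [hκ]; field_simp
  rw [mul_add, mul_add]
  refine add_le_add (add_le_add ?_ ?_) ?_
  · have e : 8 * n ^ 2 * L ^ 2 * V + 2 * n * L ^ 2 * M
        = (n * V) ^ 2 * (8 * L ^ 2 / V + 2 * L ^ 2 * κ / V ^ 2) := by
      rw [hMκ]; field_simp
    rw [e, Real.sqrt_mul (by positivity), Real.sqrt_sq (by positivity), hθ2]
    calc _ = t ^ 2 * √(8 * L ^ 2 / V + 2 * L ^ 2 * κ / V ^ 2) := by field_simp
      _ ≤ _ := by
        gcongr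
        exact div_le_self (by positivity) (one_le_pow₀ hV1)
  · have e : (4 * n ^ 2 * L ^ 2 + 3 * n * M) * M
        = n ^ 2 * (n * (4 * L ^ 2 * κ + 3 * κ ^ 2)) := by
      rw [hMκ]; ring
    have hsn : √(n : ℝ) ^ 2 = n := Real.sq_sqrt hn'.le
    rw [e, Real.sqrt_mul (x := (n : ℝ) ^ 2) (by positivity), Real.sqrt_sq hn'.le,
      Real.sqrt_mul (x := (n : ℝ)) hn'.le, Real.sqrt_mul (x := (n : ℝ)) hn'.le, hθ, abs_mul, abs_of_pos (a := √2 / (n * √V)) (by positivity)]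
    set w := √(4 * L ^ 2 * κ + 3 * κ ^ 2)
    have hw : 0 ≤ w := Real.sqrt_nonneg _
    have hs23 : √2 ^ 3 ≤ 3 := by
      have : √2 ≤ 1.5 := Real.sqrt_le_iff.2 (by norm_num)
      calc √2 ^ 3 = √2 ^ 2 * √2 := by ring
        _ ≤ 3 := by rw [hs2]; linarith
    calc _ = 4 * √2 ^ 3 * |t| ^ 3 * w * (√(n : ℝ) ^ 2 / n) / √V ^ 2 := by field_simp
      _ = 4 * √2 ^ 3 * |t| ^ 3 * w / V := by rw [hsn, hsV2, div_self hn'.ne', mul_one]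
      _ ≤ 4 * √2 ^ 3 * |t| ^ 3 * w := div_le_self (by positivity) hV1
      _ ≤ 4 * 3 * |t| ^ 3 * w := by gcongr
      _ = _ := by ring
  · rw [hθ2]
    apply le_of_eq
    field_simp

end IsCentredIID

end GaussianApproximation

end

/-! ### A central limit theorem for quadratic forms in a triangular array -/

/-- Let the `n`-th row of a triangular array be an i.i.d. sequence in a Hilbert space `E n`, whose
covariance operators `S n` are bounded uniformly in `n`. If `V n = tr (S n)²` tends to infinity and
the fourth moment of the norm is `o(n)`, then `‖X₁ + ⋯ + Xₙ‖² / n`, centred and divided by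
`√(2 V n)`, is asymptotically standard normal. -/
theorem tendstoInDistribution_norm_partialSum_sq {Ω : Type*} [MeasurableSpace Ω] {P : Measure Ω}
    [IsProbabilityMeasure P] {E : ℕ → Type*} [∀ n, NormedAddCommGroup (E n)]
    [∀ n, InnerProductSpace ℝ (E n)] [∀ n, CompleteSpace (E n)]
    [∀ n, SecondCountableTopology (E n)] [∀ n, MeasurableSpace (E n)] [∀ n, BorelSpace (E n)]
    {μ : ∀ n, Measure (E n)} {X : ∀ n, ℕ → Ω → E n} (h : ∀ n, IsCentredIID P (X n) (μ n))
    {L : ℝ} (hL0 : 0 ≤ L) (hL : ∀ n, ∀ a : E n, covQuad (μ n) a ≤ L * ‖a‖ ^ 2) {V : ℕ → ℝ}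
    (hV : ∀ n, ∫ x, covQuad (μ n) x ∂(μ n) = V n) (hVtop : Tendsto V atTop atTop)
    (hM : Tendsto (fun n : ℕ => (∫ x, ‖x‖ ^ 4 ∂(μ n)) / n) atTop (𝓝 0)) {S : ℕ → Ω → ℝ}
    (hSm : ∀ n, AEMeasurable (S n) P)
    (hS : ∀ᶠ n : ℕ in atTop, ∀ ω, S n ω = (√2 * √(V n))⁻¹ *
      (‖partialSum (fun i => X n i ω) n‖ ^ 2 / n - ∫ x, ‖x‖ ^ 2 ∂(μ n))) :
    TendstoInDistribution S atTop (id : ℝ → ℝ) (fun _ => P) (gaussianReal 0 1) := by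
  refine ⟨hSm, aemeasurable_id, ProbabilityMeasure.tendsto_of_tendsto_charFun fun t => ?_⟩
  simp only [ProbabilityMeasure.coe_mk, Measure.map_id]
  have hinv : Tendsto (fun n : ℕ => 1 / (n : ℝ)) atTop (𝓝 0) := tendsto_one_div_atTop_nhds_zero_nat
  set κ : ℕ → ℝ := fun n => (∫ x, ‖x‖ ^ 4 ∂(μ n)) / n with hκ
  -- the error bound tends to zero
  have hbound : Tendsto (fun n : ℕ => |t| * √(κ n) + (t ^ 2 * √(8 * L ^ 2 / V n + 2 * L ^ 2 * κ n)
      + 12 * |t| ^ 3 * √(4 * L ^ 2 * κ n + 3 * κ n ^ 2) + t ^ 4 / n)) atTop (𝓝 0) := by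
    have t1 : Tendsto (fun n => √(κ n)) atTop (𝓝 0) := by simpa using hM.sqrt
    have t2 : Tendsto (fun n => √(8 * L ^ 2 / V n + 2 * L ^ 2 * κ n)) atTop (𝓝 0) := by
      simpa using ((hVtop.const_div_atTop (8 * L ^ 2)).add (hM.const_mul (2 * L ^ 2))).sqrt
    have t3 : Tendsto (fun n => √(4 * L ^ 2 * κ n + 3 * κ n ^ 2)) atTop (𝓝 0) := by
      simpa using ((hM.const_mul (4 * L ^ 2)).add ((hM.pow 2).const_mul 3)).sqrt
    have t4 : Tendsto (fun n : ℕ => t ^ 4 / (n : ℝ)) atTop (𝓝 0) :=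
      tendsto_const_div_atTop_nhds_zero_nat _
    simpa using (t1.const_mul |t|).add (((t2.const_mul (t ^ 2)).add
      (t3.const_mul (12 * |t| ^ 3))).add t4)
  have hgauss : Tendsto (fun n : ℕ => ((Real.exp (-(t ^ 2 * (1 - 1 / (n : ℝ)) / 2)) : ℝ) : ℂ)) atTop
      (𝓝 (charFun (gaussianReal 0 1) t)) := by
    have e : charFun (gaussianReal 0 1) t = ((Real.exp (-(t ^ 2 * (1 - 0) / 2)) : ℝ) : ℂ) := by
      rw [charFun_gaussianReal]
      push_cast
      congr 1
      simp
    rw [e]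
    exact (Complex.continuous_ofReal.tendsto _).comp ((Real.continuous_exp.tendsto _).comp
      ((((tendsto_const_nhds.sub hinv).const_mul (t ^ 2)).div_const 2).neg))
  have hdiff : Tendsto (fun n : ℕ => charFun (P.map (S n)) t
      - ((Real.exp (-(t ^ 2 * (1 - 1 / (n : ℝ)) / 2)) : ℝ) : ℂ)) atTop (𝓝 0) := by
    refine squeeze_zero_norm' ?_ hbound
    filter_upwards [hS, eventually_gt_atTop 0, hVtop.eventually_ge_atTop 1] with n hSn hn hVn
    have hc : charFun (P.map (S n)) t = ∫ ω, Complex.exp (t * S n ω * Complex.I) ∂P := by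
      rw [charFun_apply_real, integral_map (hSm n)
        (Continuous.aestronglyMeasurable (by fun_prop))]
    rw [hc]
    simp_rw [hSn]
    exact (h n).norm_integral_cexp_norm_partialSum_sq_sub_le hL0 (hL n) t (hV n) rfl hVn hn
  simpa using hdiff.add hgauss

section

variable {Ω : Type*} [MeasurableSpace Ω] {P : Measure Ω} [IsProbabilityMeasure P]

/-! ### Moments of the error term weighted by functions of the instrument -/

section Weighted

variable {dw : ℕ} {W : Ω → Vec dw} {U : Ω → ℝ} {pW ν : Vec dw → ℝ} {f : ℕ → Vec dw → ℝ}

/-- The bound on `p_W / ν` over the support of `W` says that the law of `W` is dominated by a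
multiple of the measure with density `ν`. -/
lemma map_le_smul_densityMeasure (hsetup : BasisSetup P W pW ν f) {ηp : ℝ}
    (hηp : ∀ w ∈ (P.map W).support, pW w / ν w ≤ ηp) (hη0 : 0 ≤ ηp) :
    P.map W ≤ ENNReal.ofReal ηp • densityMeasure ν := by
  refine Measure.le_iff.2 fun A hA => ?_
  set s := (P.map W).support with hs
  have hsm : MeasurableSet s := Measure.isClosed_support.measurableSet
  have h1 : P.map W A = P.map W (A ∩ s) :=
    (measure_inter_conull (by simp [hs])).symm
  rw [h1, hsetup.law_W, Measure.smul_apply, smul_eq_mul, densityMeasure, densityMeasure,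
    withDensity_apply _ (hA.inter hsm), withDensity_apply _ hA,
    ← lintegral_const_mul _ hsetup.density_ν.measurable.ennreal_ofReal]
  calc ∫⁻ w in A ∩ s, ENNReal.ofReal (pW w)
      ≤ ∫⁻ w in A ∩ s, ENNReal.ofReal ηp * ENNReal.ofReal (ν w) := by
        refine setLIntegral_mono' (hA.inter hsm) fun w hw => ?_
        rw [← ENNReal.ofReal_mul hη0]
        exact ENNReal.ofReal_le_ofReal ((div_le_iff₀ (hsetup.pos_ν w hw.2)).1 (hηp w hw.2))
    _ ≤ _ := lintegral_mono_set Set.inter_subset_left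

/-- The conditional moment bound `E[U⁴ | W] ≤ c`, as an inequality between measures. -/
lemma map_withDensity_pow_four_le (hW : Measurable W) {c : ℝ} (hc : 0 ≤ c)
    (hU : Integrable (fun ω => U ω ^ 4) P)
    (hUc : ∀ᵐ ω ∂P, condExpGiven P W (fun ω => U ω ^ 4) ω ≤ c) :
    (P.withDensity fun ω => ENNReal.ofReal (U ω ^ 4)).map W ≤ ENNReal.ofReal c • P.map W := by
  refine Measure.le_iff.2 fun A hA => ?_
  have hle : MeasurableSpace.comap W inferInstance ≤ (inferInstance : MeasurableSpace Ω) :=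
    hW.comap_le
  have h4 : ∀ ω, 0 ≤ U ω ^ 4 := fun ω => by positivity
  rw [Measure.map_apply hW hA, withDensity_apply _ (hW hA), Measure.smul_apply, smul_eq_mul,
    Measure.map_apply hW hA,
    ← ofReal_integral_eq_lintegral_ofReal hU.integrableOn (ae_of_all _ h4),
    ← setIntegral_condExp hle hU ⟨A, hA, rfl⟩]
  calc _ ≤ ENNReal.ofReal (∫ ω in W ⁻¹' A, c ∂P) := by
        refine ENNReal.ofReal_le_ofReal (setIntegral_mono_ae integrable_condExp.integrableOn
          (integrable_const c).integrableOn hUc)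
    _ = _ := by
        rw [setIntegral_const, smul_eq_mul, mul_comm, ENNReal.ofReal_mul hc, ofReal_measureReal]

/-- Weighted moments: if the law of `W` reweighted by `u ≥ 0` is dominated by `C · ν`, then
`E[u g(W)] ≤ C ∫ g ν`. -/
lemma integral_mul_comp_le {u : Ω → ℝ} (hu : AEMeasurable u P) (hu0 : ∀ ω, 0 ≤ u ω)
    (hW : Measurable W) {ρ : Measure (Vec dw)} {C : ℝ} (hC : 0 ≤ C)
    (hle : (P.withDensity fun ω => ENNReal.ofReal (u ω)).map W ≤ ENNReal.ofReal C • ρ)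
    {g : Vec dw → ℝ} (hg0 : ∀ w, 0 ≤ g w) (hgW : AEMeasurable (fun ω => g (W ω)) P)
    (hg : Integrable g ρ) :
    Integrable (fun ω => u ω * g (W ω)) P ∧ ∫ ω, u ω * g (W ω) ∂P ≤ C * ∫ w, g w ∂ρ := by
  have hac : (P.withDensity fun ω => ENNReal.ofReal (u ω)).map W ≪ ρ :=
    (Measure.absolutelyContinuous_of_le hle).trans (Measure.smul_absolutelyContinuous)
  have hgm : AEMeasurable (fun w => ENNReal.ofReal (g w))
      ((P.withDensity fun ω => ENNReal.ofReal (u ω)).map W) :=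
    (hg.1.aemeasurable.mono_ac hac).ennreal_ofReal
  have key : ∫⁻ ω, ENNReal.ofReal (u ω * g (W ω)) ∂P ≤ ENNReal.ofReal (C * ∫ w, g w ∂ρ) := by
    calc ∫⁻ ω, ENNReal.ofReal (u ω * g (W ω)) ∂P
        = ∫⁻ ω, ENNReal.ofReal (u ω) * ENNReal.ofReal (g (W ω)) ∂P := by
          simp_rw [ENNReal.ofReal_mul (hu0 _)]
      _ = ∫⁻ ω, ENNReal.ofReal (g (W ω)) ∂(P.withDensity fun ω => ENNReal.ofReal (u ω)) := by
          rw [lintegral_withDensity_eq_lintegral_mul₀ hu.ennreal_ofReal hgW.ennreal_ofReal]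
          rfl
      _ = ∫⁻ w, ENNReal.ofReal (g w) ∂(P.withDensity fun ω => ENNReal.ofReal (u ω)).map W :=
          (lintegral_map' hgm hW.aemeasurable).symm
      _ ≤ ∫⁻ w, ENNReal.ofReal (g w) ∂(ENNReal.ofReal C • ρ) := lintegral_mono' hle le_rfl
      _ = _ := by
          rw [lintegral_smul_measure, smul_eq_mul, ENNReal.ofReal_mul hC,
            ofReal_integral_eq_lintegral_ofReal hg (ae_of_all _ hg0)]
  have hm : AEStronglyMeasurable (fun ω => u ω * g (W ω)) P := (hu.mul hgW).aestronglyMeasurable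
  have h0 : ∀ ω, 0 ≤ u ω * g (W ω) := fun ω => mul_nonneg (hu0 _) (hg0 _)
  refine ⟨⟨hm, ?_⟩, ?_⟩
  · rw [hasFiniteIntegral_iff_ofReal (ae_of_all _ h0)]
    exact key.trans_lt ENNReal.ofReal_lt_top
  · rw [integral_eq_lintegral_of_nonneg_ae (ae_of_all _ h0) hm]
    exact ENNReal.toReal_le_of_le_ofReal
      (mul_nonneg hC (integral_nonneg hg0)) key

/-- `E[U | W] = 0` makes `U` orthogonal to every function of `W`. -/
lemma integral_mul_comp_eq_zero (hW : Measurable W) (hU : Integrable U P)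
    (hUW : condExpGiven P W U =ᵐ[P] 0) {g : Vec dw → ℝ} (hg : AEMeasurable g (P.map W))
    (hUg : Integrable (fun ω => U ω * g (W ω)) P) : ∫ ω, U ω * g (W ω) ∂P = 0 := by
  have hle : MeasurableSpace.comap W inferInstance ≤ (inferInstance : MeasurableSpace Ω) :=
    hW.comap_le
  have hae : (fun ω => g (W ω)) =ᵐ[P] fun ω => hg.mk g (W ω) :=
    ae_of_ae_map hW.aemeasurable hg.ae_eq_mk
  have hae' : (fun ω => U ω * g (W ω)) =ᵐ[P] U * fun ω => hg.mk g (W ω) := by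
    filter_upwards [hae] with ω hω
    simp [hω]
  have hsm : StronglyMeasurable[MeasurableSpace.comap W inferInstance] fun ω => hg.mk g (W ω) :=
    (hg.measurable_mk.comp (comap_measurable W)).stronglyMeasurable
  rw [integral_congr_ae hae', ← integral_condExp hle]
  refine (integral_congr_ae ?_).trans (integral_zero _ _)
  filter_upwards [condExp_mul_of_stronglyMeasurable_right hsm (hUg.congr hae') hU, hUW]
    with ω h1 h2
  rw [h1, Pi.mul_apply]
  rw [condExpGiven] at h2
  rw [h2]
  simp

end Weighted

/-! ### The basis functions -/

section Basis

variable {d : ℕ} {f : ℕ → Vec d → ℝ} {ν : Vec d → ℝ}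

lemma IsOrthonormalBasisOf.memLp (hf : IsOrthonormalBasisOf f ν) (j : ℕ) :
    MemLp (f j) 2 (densityMeasure ν) := by
  obtain ⟨b, hb⟩ := hf
  exact (Lp.memLp (b j)).ae_eq (hb j)

lemma IsOrthonormalBasisOf.integral_mul (hf : IsOrthonormalBasisOf f ν) (j l : ℕ) :
    ∫ s, f j s * f l s ∂(densityMeasure ν) = if j = l then 1 else 0 := by
  obtain ⟨b, hb⟩ := hf
  have h := orthonormal_iff_ite.1 b.orthonormal j l
  rw [← h, L2.inner_def]
  refine integral_congr_ae ?_
  filter_upwards [hb j, hb l] with s h1 h2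
  rw [h1, h2]
  simp [mul_comm]

lemma IsOrthonormalBasisOf.integral_sum_sq (hf : IsOrthonormalBasisOf f ν) {m : ℕ}
    (c : Fin m → ℝ) :
    ∫ s, (∑ j, c j * f j s) ^ 2 ∂(densityMeasure ν) = ∑ j, c j ^ 2 := by
  have hi : ∀ j l : Fin m, Integrable (fun s => (c j * f j s) * (c l * f l s))
      (densityMeasure ν) := fun j l =>
    ((hf.memLp j).const_mul (c j)).integrable_mul ((hf.memLp l).const_mul (c l))
  simp_rw [sq (∑ j, _), Finset.sum_mul_sum]
  rw [integral_finsetSum _ fun j _ => integrable_finsetSum _ fun l _ => hi j l]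
  refine Finset.sum_congr rfl fun j _ => ?_
  rw [integral_finsetSum _ fun l _ => hi j l]
  have : ∀ l : Fin m, ∫ s, (c j * f j s) * (c l * f l s) ∂(densityMeasure ν)
      = if j = l then c j ^ 2 else 0 := fun l => by
    have e : ∀ s, (c j * f j s) * (c l * f l s) = (c j * c l) * (f j s * f l s) := fun s => by ring
    simp_rw [e]
    rw [integral_const_mul, hf.integral_mul]
    by_cases hjl : j = l
    · simp [hjl, sq]
    · simp [hjl, Fin.val_inj]
  simp [this]

end Basis

end

/-! ### The score vectors -/

/-- The vector `(√τ_j f_j(w) u)_{j < m}`; the test statistic is the squared norm of the mean of the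
score vectors at `u = Y_i - φ₀(Z_i)`, `w = W_i`. -/
def scoreVec {dw : ℕ} (f : ℕ → Vec dw → ℝ) (τ : ℕ → ℝ) (m : ℕ) (u : ℝ) (w : Vec dw) :
    EuclideanSpace ℝ (Fin m) :=
  WithLp.toLp 2 fun j => √(τ j) * f j w * u

section Score

variable {Ω : Type*} [MeasurableSpace Ω] {P : Measure Ω} [IsProbabilityMeasure P]
  {dw : ℕ} {W : Ω → Vec dw} {U : Ω → ℝ} {f : ℕ → Vec dw → ℝ} {τ : ℕ → ℝ} {m : ℕ}

@[simp] lemma scoreVec_apply (u : ℝ) (w : Vec dw) (j : Fin m) :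
    scoreVec f τ m u w j = √(τ j) * f j w * u := rfl

lemma inner_scoreVec (a : EuclideanSpace ℝ (Fin m)) (u : ℝ) (w : Vec dw) :
    ⟪a, scoreVec f τ m u w⟫ = (∑ j, a j * √(τ j) * f j w) * u := by
  simp only [PiLp.inner_apply, scoreVec_apply, Finset.sum_mul]
  refine Finset.sum_congr rfl fun j _ => ?_
  simp only [RCLike.inner_apply, conj_trivial]
  ring

lemma norm_scoreVec_sq (hτ : ∀ j, 0 < τ j) (u : ℝ) (w : Vec dw) :
    ‖scoreVec f τ m u w‖ ^ 2 = (∑ j : Fin m, τ j * f j w ^ 2) * u ^ 2 := by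
  rw [EuclideanSpace.norm_sq_eq, Finset.sum_mul]
  refine Finset.sum_congr rfl fun j _ => ?_
  rw [scoreVec_apply, Real.norm_eq_abs, sq_abs, mul_pow, mul_pow, Real.sq_sqrt (hτ j).le]

lemma norm_scoreVec_pow_four_le (hτ : ∀ j, 0 < τ j) (u : ℝ) (w : Vec dw) :
    ‖scoreVec f τ m u w‖ ^ 4
      ≤ u ^ 4 * ((∑ j : Fin m, τ j) * ∑ j : Fin m, τ j * f j w ^ 4) := by
  have h : (∑ j : Fin m, τ j * f j w ^ 2) ^ 2
      ≤ (∑ j : Fin m, τ j) * ∑ j : Fin m, τ j * f j w ^ 4 := by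
    refine Finset.sum_sq_le_sum_mul_sum_of_sq_le_mul _ (fun j _ => (hτ j).le)
      (fun j _ => mul_nonneg (hτ j).le (by positivity)) fun j _ => le_of_eq (by ring)
  calc ‖scoreVec f τ m u w‖ ^ 4 = (‖scoreVec f τ m u w‖ ^ 2) ^ 2 := by ring
    _ = u ^ 4 * (∑ j : Fin m, τ j * f j w ^ 2) ^ 2 := by rw [norm_scoreVec_sq hτ]; ring
    _ ≤ _ := by gcongr

lemma aemeasurable_scoreVec {α : Type*} [MeasurableSpace α] {κ : Measure α} {u : α → ℝ}
    {w : α → Vec dw} (hu : AEMeasurable u κ) (hf : ∀ j, AEMeasurable (fun x => f j (w x)) κ) :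
    AEMeasurable (fun x => scoreVec f τ m (u x) (w x)) κ :=
  (WithLp.measurable_toLp 2 _).comp_aemeasurable
    (aemeasurable_pi_lambda _ fun j => ((hf j).const_mul _).mul hu)

end Score

/-- The consequences of the assumptions of the model that the score vectors inherit: the weighted
moments of `U` are dominated by integrals against `ρ`, the measure with density `ν`. -/
structure ScoreBounds {Ω : Type*} [MeasurableSpace Ω] (P : Measure Ω) {dw : ℕ} (W : Ω → Vec dw)
    (U : Ω → ℝ) (f : ℕ → Vec dw → ℝ) (ρ : Measure (Vec dw)) (C K : ℝ) : Prop where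
  aemeasurable_U : AEMeasurable U P
  aemeasurable_comp : ∀ j, AEMeasurable (fun ω => f j (W ω)) P
  C_nonneg : 0 ≤ C
  sq_le : ∀ g : Vec dw → ℝ, (∀ w, 0 ≤ g w) → AEMeasurable (fun ω => g (W ω)) P →
    Integrable g ρ → Integrable (fun ω => U ω ^ 2 * g (W ω)) P ∧
      ∫ ω, U ω ^ 2 * g (W ω) ∂P ≤ C * ∫ w, g w ∂ρ
  integrable_four : ∀ j, Integrable (fun ω => U ω ^ 4 * f j (W ω) ^ 4) P
  four_le : ∀ j, ∫ ω, U ω ^ 4 * f j (W ω) ^ 4 ∂P ≤ K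
  mean_eq_zero : ∀ j, ∫ ω, U ω * f j (W ω) ∂P = 0

namespace ScoreBounds

variable {Ω : Type*} [MeasurableSpace Ω] {P : Measure Ω} [IsProbabilityMeasure P]
  {dw : ℕ} {W : Ω → Vec dw} {U : Ω → ℝ} {f : ℕ → Vec dw → ℝ} {τ : ℕ → ℝ} {m : ℕ}
  {ν : Vec dw → ℝ} {C K : ℝ}

/-- The law of the population score vector. -/
def scoreLaw (P : Measure Ω) (W : Ω → Vec dw) (U : Ω → ℝ) (f : ℕ → Vec dw → ℝ) (τ : ℕ → ℝ)
    (m : ℕ) : Measure (EuclideanSpace ℝ (Fin m)) :=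
  P.map fun ω => scoreVec f τ m (U ω) (W ω)

lemma aemeasurable_score (h : ScoreBounds P W U f (densityMeasure ν) C K) :
    AEMeasurable (fun ω => scoreVec f τ m (U ω) (W ω)) P :=
  aemeasurable_scoreVec h.aemeasurable_U h.aemeasurable_comp

lemma integrable_norm_pow_four (h : ScoreBounds P W U f (densityMeasure ν) C K)
    (hτ : ∀ j, 0 < τ j) :
    Integrable (fun ω => ‖scoreVec f τ m (U ω) (W ω)‖ ^ 4) P ∧
      ∫ ω, ‖scoreVec f τ m (U ω) (W ω)‖ ^ 4 ∂P ≤ K * (∑ j ∈ Finset.range m, τ j) ^ 2 := by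
  set t := ∑ j ∈ Finset.range m, τ j with ht
  have htF : ∑ j : Fin m, τ j = t := Fin.sum_univ_eq_sum_range τ m
  have ht0 : 0 ≤ t := Finset.sum_nonneg fun j _ => (hτ j).le
  have hle : ∀ ω, ‖scoreVec f τ m (U ω) (W ω)‖ ^ 4
      ≤ t * ∑ j : Fin m, τ j * (U ω ^ 4 * f j (W ω) ^ 4) := fun ω => by
    refine (norm_scoreVec_pow_four_le hτ _ _).trans_eq ?_
    rw [htF, mul_left_comm, Finset.mul_sum]
    congr 1
    exact Finset.sum_congr rfl fun j _ => by ring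
  have hi : Integrable (fun ω => t * ∑ j : Fin m, τ j * (U ω ^ 4 * f j (W ω) ^ 4)) P :=
    (integrable_finsetSum _ fun (j : Fin m) _ => (h.integrable_four j).const_mul (τ j)).const_mul _
  have hi4 : Integrable (fun ω => ‖scoreVec f τ m (U ω) (W ω)‖ ^ 4) P := by
    refine hi.mono' (h.aemeasurable_score.norm.pow_const 4).aestronglyMeasurable
      (ae_of_all _ fun ω => ?_)
    rw [Real.norm_of_nonneg (by positivity)]
    exact hle ω
  refine ⟨hi4, (integral_mono hi4 hi hle).trans ?_⟩
  rw [integral_const_mul, integral_finsetSum _ fun (j : Fin m) _ =>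
    (h.integrable_four j).const_mul (τ j)]
  calc _ ≤ t * ∑ j : Fin m, τ j * K := by
        gcongr with j _
        rw [integral_const_mul]
        exact mul_le_mul_of_nonneg_left (h.four_le j) (hτ j).le
    _ = _ := by rw [← Finset.sum_mul, htF]; ring

lemma memLp_score (h : ScoreBounds P W U f (densityMeasure ν) C K) (hτ : ∀ j, 0 < τ j) :
    MemLp (fun ω => scoreVec f τ m (U ω) (W ω)) 4 P := by
  refine (integrable_norm_rpow_iff h.aemeasurable_score.aestronglyMeasurable (by norm_num)
    (by norm_num)).1 ?_
  simpa using (h.integrable_norm_pow_four hτ).1.congr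
    (ae_of_all _ fun ω => (Real.rpow_natCast _ 4).symm)

lemma memLp_scoreLaw (h : ScoreBounds P W U f (densityMeasure ν) C K) (hτ : ∀ j, 0 < τ j) :
    MemLp id 4 (scoreLaw P W U f τ m) :=
  (memLp_map_measure_iff aestronglyMeasurable_id h.aemeasurable_score).2 (h.memLp_score hτ)

lemma isProbabilityMeasure_scoreLaw (h : ScoreBounds P W U f (densityMeasure ν) C K) :
    IsProbabilityMeasure (scoreLaw P W U f τ m) :=
  Measure.isProbabilityMeasure_map h.aemeasurable_score

lemma memLp_two_scoreLaw (h : ScoreBounds P W U f (densityMeasure ν) C K) (hτ : ∀ j, 0 < τ j) :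
    MemLp id 2 (scoreLaw P W U f τ m) :=
  have := h.isProbabilityMeasure_scoreLaw (τ := τ) (m := m)
  memLp_two_of_four (h.memLp_scoreLaw hτ)

lemma integral_scoreLaw (h : ScoreBounds P W U f (densityMeasure ν) C K)
    {g : EuclideanSpace ℝ (Fin m) → ℝ} (hg : Continuous g) :
    ∫ x, g x ∂(scoreLaw P W U f τ m) = ∫ ω, g (scoreVec f τ m (U ω) (W ω)) ∂P :=
  integral_map h.aemeasurable_score hg.aestronglyMeasurable

lemma integral_norm_pow_four_scoreLaw_le (h : ScoreBounds P W U f (densityMeasure ν) C K)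
    (hτ : ∀ j, 0 < τ j) :
    ∫ x, ‖x‖ ^ 4 ∂(scoreLaw P W U f τ m) ≤ K * (∑ j ∈ Finset.range m, τ j) ^ 2 := by
  rw [h.integral_scoreLaw (by fun_prop)]
  exact (h.integrable_norm_pow_four hτ).2

lemma integral_id_scoreLaw (h : ScoreBounds P W U f (densityMeasure ν) C K)
    (hτ : ∀ j, 0 < τ j) : ∫ x, x ∂(scoreLaw P W U f τ m) = 0 := by
  have := h.isProbabilityMeasure_scoreLaw (τ := τ) (m := m)
  have hi : Integrable (fun x => x) (scoreLaw P W U f τ m) :=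
    (h.memLp_two_scoreLaw hτ).integrable (by norm_num)
  refine ext_inner_left ℝ fun a => ?_
  rw [← integral_inner hi, h.integral_scoreLaw (by fun_prop), inner_zero_right]
  have hc : ∀ j : Fin m, Integrable (fun ω => scoreVec f τ m (U ω) (W ω) j) P := fun j => by
    have := (memLp_two_of_four (h.memLp_score (τ := τ) (m := m) hτ)).integrable (by norm_num)
    exact (EuclideanSpace.proj (𝕜 := ℝ) j).integrable_comp this
  simp only [PiLp.inner_apply, RCLike.inner_apply, conj_trivial]
  rw [integral_finsetSum _ fun j _ => (hc j).mul_const _]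
  refine Finset.sum_eq_zero fun j _ => ?_
  have e : ∀ ω, scoreVec f τ m (U ω) (W ω) j * a j
      = (√(τ j) * a j) * (U ω * f j (W ω)) := fun ω => by rw [scoreVec_apply]; ring
  simp_rw [e]
  rw [integral_const_mul, h.mean_eq_zero, mul_zero]

/-- The covariance operator of the score vector is bounded uniformly in the dimension, because the
basis functions are orthonormal and `τ ≤ 1`. -/
lemma covQuad_scoreLaw_le (h : ScoreBounds P W U f (densityMeasure ν) C K)
    (hτ : IsWeightSequence τ) (hf : IsOrthonormalBasisOf f ν) (a : EuclideanSpace ℝ (Fin m)) :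
    covQuad (scoreLaw P W U f τ m) a ≤ C * ‖a‖ ^ 2 := by
  rw [covQuad, covarianceOperator_inner_self (h.memLp_two_scoreLaw hτ.pos),
    h.integral_scoreLaw (by fun_prop)]
  have e : ∀ ω, ⟪a, scoreVec f τ m (U ω) (W ω)⟫ ^ 2
      = U ω ^ 2 * (∑ j, a j * √(τ j) * f j (W ω)) ^ 2 := fun ω => by
    rw [inner_scoreVec]; ring
  simp_rw [e]
  have hfj : ∀ j : Fin m, MemLp (fun w => a j * √(τ j) * f j w) 2 (densityMeasure ν) := fun j =>
    (hf.memLp j).const_mul (a j * √(τ j))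
  have hmj : ∀ j : Fin m, AEMeasurable (fun ω => a j * √(τ j) * f j (W ω)) P := fun j =>
    (h.aemeasurable_comp j).const_mul (a j * √(τ j))
  let g : Vec dw → ℝ := fun w => (∑ j, a j * √(τ j) * f j w) ^ 2
  have hint : Integrable g (densityMeasure ν) :=
    (memLp_finsetSum Finset.univ fun j _ => hfj j).integrable_sq
  have hm : AEMeasurable (fun ω => g (W ω)) P :=
    (Finset.aemeasurable_fun_sum Finset.univ fun j _ => hmj j).pow_const 2
  have hb := (h.sq_le g (fun w => sq_nonneg _) hm hint).2
  refine hb.trans (mul_le_mul_of_nonneg_left ?_ h.C_nonneg)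
  have hsum : ∫ w, g w ∂(densityMeasure ν) = ∑ j, (a j * √(τ j)) ^ 2 :=
    hf.integral_sum_sq fun j => a j * √(τ j)
  rw [hsum, EuclideanSpace.norm_sq_eq]
  refine Finset.sum_le_sum fun j _ => ?_
  rw [mul_pow, Real.sq_sqrt (hτ.pos j).le, Real.norm_eq_abs, sq_abs]
  have : τ j ≤ 1 := hτ.first ▸ hτ.antitone (Nat.zero_le j)
  nlinarith [sq_nonneg (a j)]

lemma integrable_score_mul (h : ScoreBounds P W U f (densityMeasure ν) C K)
    (hτ : ∀ j, 0 < τ j) (j l : Fin m) :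
    Integrable (fun ω => scoreVec f τ m (U ω) (W ω) j * scoreVec f τ m (U ω) (W ω) l) P := by
  have h2 := memLp_two_of_four (h.memLp_score (τ := τ) (m := m) hτ)
  exact ((EuclideanSpace.proj (𝕜 := ℝ) j).comp_memLp' h2).integrable_mul
    ((EuclideanSpace.proj (𝕜 := ℝ) l).comp_memLp' h2)

lemma integral_score_mul (j l : Fin m) :
    ∫ ω, scoreVec f τ m (U ω) (W ω) j * scoreVec f τ m (U ω) (W ω) l ∂P
      = covEntry P W U f τ j l := by
  unfold covEntry
  congr 1
  funext ω
  simp only [scoreVec_apply]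
  ring

lemma integral_norm_sq_scoreLaw (h : ScoreBounds P W U f (densityMeasure ν) C K)
    (hτ : ∀ j, 0 < τ j) :
    ∫ x, ‖x‖ ^ 2 ∂(scoreLaw P W U f τ m) = covTrace P W U f τ m := by
  rw [h.integral_scoreLaw (by fun_prop), covTrace,
    ← Fin.sum_univ_eq_sum_range (fun j => covEntry P W U f τ j j)]
  simp_rw [EuclideanSpace.norm_sq_eq, Real.norm_eq_abs, sq_abs, sq]
  rw [integral_finsetSum _ fun j _ => h.integrable_score_mul hτ j j]
  exact Finset.sum_congr rfl fun j _ => integral_score_mul j j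

lemma covQuad_scoreLaw (h : ScoreBounds P W U f (densityMeasure ν) C K)
    (hτ : ∀ j, 0 < τ j) (a : EuclideanSpace ℝ (Fin m)) :
    covQuad (scoreLaw P W U f τ m) a
      = ∑ j : Fin m, ∑ l : Fin m, (a j * a l) * covEntry P W U f τ j l := by
  rw [covQuad, covarianceOperator_inner_self (h.memLp_two_scoreLaw hτ),
    h.integral_scoreLaw (by fun_prop)]
  have e : ∀ ω, ⟪a, scoreVec f τ m (U ω) (W ω)⟫ ^ 2 = ∑ j : Fin m, ∑ l : Fin m, (a j * a l) *
      (scoreVec f τ m (U ω) (W ω) j * scoreVec f τ m (U ω) (W ω) l) := fun ω => by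
    simp only [PiLp.inner_apply, RCLike.inner_apply, conj_trivial]
    rw [sq, Finset.sum_mul_sum]
    exact Finset.sum_congr rfl fun j _ => Finset.sum_congr rfl fun l _ => by ring
  simp_rw [e]
  rw [integral_finsetSum _ fun j _ => integrable_finsetSum _ fun l _ =>
    (h.integrable_score_mul hτ j l).const_mul _]
  refine Finset.sum_congr rfl fun j _ => ?_
  rw [integral_finsetSum _ fun l _ => (h.integrable_score_mul hτ j l).const_mul _]
  refine Finset.sum_congr rfl fun l _ => ?_
  rw [integral_const_mul, integral_score_mul]

lemma integral_covQuad_scoreLaw (h : ScoreBounds P W U f (densityMeasure ν) C K)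
    (hτ : ∀ j, 0 < τ j) :
    ∫ x, covQuad (scoreLaw P W U f τ m) x ∂(scoreLaw P W U f τ m)
      = covFrobenius P W U f τ m ^ 2 := by
  rw [h.integral_scoreLaw continuous_covQuad, covFrobenius, Real.sq_sqrt
    (Finset.sum_nonneg fun j _ => Finset.sum_nonneg fun l _ => sq_nonneg _)]
  simp_rw [h.covQuad_scoreLaw hτ]
  rw [integral_finsetSum _ fun j _ => integrable_finsetSum _ fun l _ =>
      (h.integrable_score_mul hτ j l).mul_const _,
    ← Fin.sum_univ_eq_sum_range (fun j => ∑ l ∈ Finset.range m, covEntry P W U f τ j l ^ 2)]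
  refine Finset.sum_congr rfl fun j _ => ?_
  rw [integral_finsetSum _ fun l _ => (h.integrable_score_mul hτ j l).mul_const _,
    ← Fin.sum_univ_eq_sum_range (fun l => covEntry P W U f τ j l ^ 2)]
  refine Finset.sum_congr rfl fun l _ => ?_
  rw [integral_mul_const, integral_score_mul, sq]

end ScoreBounds

section Model

variable {Ω : Type*} [MeasurableSpace Ω] {P : Measure Ω} [IsProbabilityMeasure P]
  {dz dw : ℕ} {Y : Ω → ℝ} {Z : Ω → Vec dz} {W : Ω → Vec dw} {φ : Vec dz → ℝ} {U : Ω → ℝ}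
  {pW ν : Vec dw → ℝ} {f : ℕ → Vec dw → ℝ}

lemma map_absolutelyContinuous (hsetup : BasisSetup P W pW ν f)
    (hA1 : BasisDensityBounds P W pW ν f) : P.map W ≪ densityMeasure ν := by
  obtain ⟨ηf, ηp, hf1, hp1, hf4, hp⟩ := hA1
  exact (Measure.absolutelyContinuous_of_le
    (map_le_smul_densityMeasure hsetup hp (by linarith))).trans Measure.smul_absolutelyContinuous

lemma aemeasurable_basis (hsetup : BasisSetup P W pW ν f)
    (hA1 : BasisDensityBounds P W pW ν f) (j : ℕ) : AEMeasurable (f j) (P.map W) :=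
  (hsetup.basis.memLp j).1.aemeasurable.mono_ac (map_absolutelyContinuous hsetup hA1)

lemma exists_scoreBounds (hmodel : IVModel P Y Z W φ U) (hsetup : BasisSetup P W pW ν f)
    (hA1 : BasisDensityBounds P W pW ν f) (hA2 : CondFourthMomentBound P W U) :
    ∃ C K : ℝ, ScoreBounds P W U f (densityMeasure ν) C K := by
  have hW := hmodel.measurable_W
  have hfW : ∀ j, AEMeasurable (fun ω => f j (W ω)) P := fun j =>
    (aemeasurable_basis hsetup hA1 j).comp_measurable hW
  have hfm := aemeasurable_basis hsetup hA1
  obtain ⟨ηf, ηp, hf1, hp1, hf4, hp⟩ := hA1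
  obtain ⟨σ, hσ, hU4, hσ4⟩ := hA2
  have hUm : AEMeasurable U P := hmodel.integrable_U.1.aemeasurable
  have hηp0 : 0 ≤ ηp := by linarith
  have hρ := map_le_smul_densityMeasure hsetup hp hηp0
  have hc0 : 0 ≤ σ ^ 4 := by positivity
  have hC0 : 0 ≤ σ ^ 4 * ηp := by positivity
  have h4 : (P.withDensity fun ω => ENNReal.ofReal (U ω ^ 4)).map W
      ≤ ENNReal.ofReal (σ ^ 4 * ηp) • densityMeasure ν := by
    refine (map_withDensity_pow_four_le hW hc0 hU4 hσ4).trans ?_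
    rw [ENNReal.ofReal_mul hc0, mul_smul]
    gcongr
  have h1 : (P.withDensity fun _ => ENNReal.ofReal 1).map W
      ≤ ENNReal.ofReal ηp • densityMeasure ν := by
    simpa using hρ
  have hf4int : ∀ j, Integrable (fun s => f j s ^ 4) (densityMeasure ν) ∧
      ∫ s, f j s ^ 4 ∂(densityMeasure ν) ≤ ηf := fun j => by
    have hm : AEStronglyMeasurable (fun s => f j s ^ 4) (densityMeasure ν) :=
      (hsetup.basis.memLp j).1.pow 4
    have h0 : ∀ s, 0 ≤ f j s ^ 4 := fun s => by positivity
    have hj := hf4 j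
    simp_rw [(show Even 4 by decide).pow_abs] at hj
    refine ⟨⟨hm, ?_⟩, ?_⟩
    · rw [hasFiniteIntegral_iff_ofReal (ae_of_all _ h0)]
      exact hj.trans_lt ENNReal.ofReal_lt_top
    · rw [integral_eq_lintegral_of_nonneg_ae (ae_of_all _ h0) hm]
      exact ENNReal.toReal_le_of_le_ofReal (by linarith) hj
  have hsq : ∀ g : Vec dw → ℝ, (∀ w, 0 ≤ g w) → AEMeasurable (fun ω => g (W ω)) P →
      Integrable g (densityMeasure ν) → Integrable (fun ω => U ω ^ 2 * g (W ω)) P ∧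
        ∫ ω, U ω ^ 2 * g (W ω) ∂P ≤ (σ ^ 4 * ηp + ηp) * ∫ w, g w ∂(densityMeasure ν) := by
    intro g hg0 hgW hg
    -- `U² ≤ U⁴ + 1` reduces the second moment to the fourth
    obtain ⟨i4, b4⟩ := integral_mul_comp_le (hUm.pow_const 4) (fun ω => by positivity) hW hC0 h4
      hg0 hgW hg
    obtain ⟨i1, b1⟩ := integral_mul_comp_le (u := fun _ => 1) aemeasurable_const
      (fun ω => zero_le_one) hW hηp0 h1 hg0 hgW hg
    have hle : ∀ ω, U ω ^ 2 * g (W ω) ≤ U ω ^ 4 * g (W ω) + 1 * g (W ω) := fun ω => by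
      rw [← add_mul]
      refine mul_le_mul_of_nonneg_right ?_ (hg0 _)
      nlinarith [sq_nonneg (U ω ^ 2 - 1)]
    have i2 : Integrable (fun ω => U ω ^ 2 * g (W ω)) P := by
      refine (i4.add i1).mono' ((hUm.pow_const 2).mul hgW).aestronglyMeasurable
        (ae_of_all _ fun ω => ?_)
      rw [Real.norm_of_nonneg (mul_nonneg (sq_nonneg _) (hg0 _))]
      exact hle ω
    refine ⟨i2, (integral_mono i2 (i4.add i1) hle).trans ?_⟩
    have e := integral_add i4 i1
    simp only [Pi.add_apply]
    rw [e, add_mul]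
    exact add_le_add b4 b1
  refine ⟨σ ^ 4 * ηp + ηp, σ ^ 4 * ηp * ηf, hUm, hfW, by positivity, hsq, fun j => ?_,
    fun j => ?_, fun j => ?_⟩
  · exact (integral_mul_comp_le (hUm.pow_const 4) (fun ω => by positivity) hW hC0 h4
      (g := fun s => f j s ^ 4) (fun w => by positivity) ((hfW j).pow_const 4) (hf4int j).1).1
  · refine (integral_mul_comp_le (hUm.pow_const 4) (fun ω => by positivity) hW hC0 h4
      (g := fun s => f j s ^ 4) (fun w => by positivity) ((hfW j).pow_const 4)
      (hf4int j).1).2.trans ?_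
    exact mul_le_mul_of_nonneg_left (hf4int j).2 hC0
  · refine integral_mul_comp_eq_zero hW hmodel.integrable_U hmodel.condExp_U (hfm j) ?_
    have i2 := (hsq (fun s => f j s ^ 2) (fun w => sq_nonneg _) ((hfW j).pow_const 2)
      (hsetup.basis.memLp j).integrable_sq).1
    have hm : AEStronglyMeasurable (fun ω => U ω * f j (W ω)) P :=
      (hUm.mul (hfW j)).aestronglyMeasurable
    refine ((memLp_two_iff_integrable_sq hm).2 (i2.congr (ae_of_all _ fun ω => ?_))).integrable
      (by norm_num)
    simp only
    ring

/-- Under the null hypothesis the sample score vectors are i.i.d. and centred. -/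
lemma isCentredIID_score (hmodel : IVModel P Y Z W φ U) {Ys : ℕ → Ω → ℝ} {Zs : ℕ → Ω → Vec dz}
    {Ws : ℕ → Ω → Vec dw} (hsample : IsIIDSample P Y Z W Ys Zs Ws)
    (hfm : ∀ j, AEMeasurable (f j) (P.map W)) {C K : ℝ}
    (h : ScoreBounds P W U f (densityMeasure ν) C K) {τ : ℕ → ℝ} (hτ : ∀ j, 0 < τ j)
    {φ₀ : Vec dz → ℝ} (hH0 : φ =ᵐ[P.map Z] φ₀) (m : ℕ) :
    IsCentredIID P (fun i ω => scoreVec f τ m (Ys i ω - φ₀ (Zs i ω)) (Ws i ω))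
      (ScoreBounds.scoreLaw P W U f τ m) := by
  set D : Ω → ℝ × Vec dz × Vec dw := fun ω => (Y ω, Z ω, W ω) with hD
  set Ds : ℕ → Ω → ℝ × Vec dz × Vec dw := fun i ω => (Ys i ω, Zs i ω, Ws i ω) with hDs
  have hDm : Measurable D := hmodel.measurable_Y.prodMk
    (hmodel.measurable_Z.prodMk hmodel.measurable_W)
  have hDsm : ∀ i, AEMeasurable (Ds i) P := fun i => (hsample.identDistrib i).aemeasurable_fst
  have hlaw : ∀ i, P.map (Ds i) = P.map D := fun i => (hsample.identDistrib i).map_eq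
  let F : ℝ × Vec dz × Vec dw → EuclideanSpace ℝ (Fin m) :=
    fun p => scoreVec f τ m (p.1 - φ₀ p.2.1) p.2.2
  have hmapZ : (P.map D).map (fun p => p.2.1) = P.map Z := by
    rw [Measure.map_map (by fun_prop) hDm]; rfl
  have hmapW : (P.map D).map (fun p => p.2.2) = P.map W := by
    rw [Measure.map_map (by fun_prop) hDm]; rfl
  have hφ₀ : AEMeasurable φ₀ (P.map Z) :=
    (hmodel.memLp_structural.1.congr hH0).aemeasurable
  have hFm : AEMeasurable F (P.map D) := by
    refine aemeasurable_scoreVec (measurable_fst.aemeasurable.sub ?_) fun j => ?_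
    · exact AEMeasurable.comp_measurable (f := fun p : ℝ × Vec dz × Vec dw => p.2.1)
        (hmapZ ▸ hφ₀) (by fun_prop)
    · exact AEMeasurable.comp_measurable (f := fun p : ℝ × Vec dz × Vec dw => p.2.2)
        (hmapW ▸ hfm j) (by fun_prop)
  have hFms : ∀ i, AEMeasurable F (P.map (Ds i)) := fun i => hlaw i ▸ hFm
  have hmap : (P.map D).map F = ScoreBounds.scoreLaw P W U f τ m := by
    rw [AEMeasurable.map_map_of_aemeasurable hFm hDm.aemeasurable, ScoreBounds.scoreLaw]
    refine Measure.map_congr ?_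
    filter_upwards [hmodel.eq_add, ae_of_ae_map hmodel.measurable_Z.aemeasurable hH0]
      with ω h1 h2
    simp only [F, D, Function.comp]
    rw [h1, h2]
    congr 1
    ring
  refine ⟨fun i => (hFms i).comp_aemeasurable (hDsm i), fun i => ?_,
    hsample.indep.comp₀ (fun _ => F) hDsm hFms, h.memLp_scoreLaw hτ, h.integral_id_scoreLaw hτ⟩
  rw [← hmap, ← hlaw i, AEMeasurable.map_map_of_aemeasurable (hFms i) (hDsm i)]
  rfl

lemma mul_testStat_eq {Ys : ℕ → Ω → ℝ} {Zs : ℕ → Ω → Vec dz} {Ws : ℕ → Ω → Vec dw}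
    {τ : ℕ → ℝ} (hτ : ∀ j, 0 < τ j) (φ₀ : Vec dz → ℝ) {n : ℕ} (hn : 0 < n) (m : ℕ) (ω : Ω) :
    n * testStat Ys Zs Ws φ₀ f τ n m ω
      = ‖partialSum (fun i => scoreVec f τ m (Ys i ω - φ₀ (Zs i ω)) (Ws i ω)) n‖ ^ 2 / n := by
  have hn' : (n : ℝ) ≠ 0 := by positivity
  have hj : ∀ j : Fin m,
      partialSum (fun i => scoreVec f τ m (Ys i ω - φ₀ (Zs i ω)) (Ws i ω)) n j
        = √(τ j) * ∑ i ∈ Finset.range n, (Ys i ω - φ₀ (Zs i ω)) * f j (Ws i ω) := fun j => by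
    simp only [partialSum, WithLp.ofLp_sum, Finset.sum_apply, scoreVec_apply, Finset.mul_sum]
    exact Finset.sum_congr rfl fun i _ => by ring
  rw [testStat, EuclideanSpace.norm_sq_eq, ← Fin.sum_univ_eq_sum_range (fun j => τ j *
    |(n : ℝ)⁻¹ * ∑ i ∈ Finset.range n, (Ys i ω - φ₀ (Zs i ω)) * f j (Ws i ω)| ^ 2),
    Finset.mul_sum, Finset.sum_div]
  refine Finset.sum_congr rfl fun j _ => ?_
  rw [hj, Real.norm_eq_abs, sq_abs, sq_abs, mul_pow, mul_pow, Real.sq_sqrt (hτ j).le]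
  field_simp

lemma aemeasurable_testStat {Ys : ℕ → Ω → ℝ} {Zs : ℕ → Ω → Vec dz} {Ws : ℕ → Ω → Vec dw}
    {τ : ℕ → ℝ} (hτ : ∀ j, 0 < τ j) (φ₀ : Vec dz → ℝ) (n m : ℕ) {μ : Measure _}
    (h : IsCentredIID P (fun i ω => scoreVec f τ m (Ys i ω - φ₀ (Zs i ω)) (Ws i ω)) μ) :
    AEMeasurable (testStat Ys Zs Ws φ₀ f τ n m) P := by
  rcases Nat.eq_zero_or_pos n with rfl | hn
  · have : testStat Ys Zs Ws φ₀ f τ 0 m = fun _ => 0 := by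
      funext ω
      simp [testStat]
    rw [this]
    exact aemeasurable_const
  · have hn' : (n : ℝ) ≠ 0 := by positivity
    have : testStat Ys Zs Ws φ₀ f τ n m = fun ω => (n : ℝ)⁻¹ *
        (‖partialSum (fun i => scoreVec f τ m (Ys i ω - φ₀ (Zs i ω)) (Ws i ω)) n‖ ^ 2 / n) := by
      funext ω
      rw [← mul_testStat_eq hτ φ₀ hn]
      field_simp
    rw [this]
    exact (((h.aemeasurable_partialSum n).norm.pow_const 2).div_const _).const_mul _

end Model

end NPIV

end

theorem mainTheorem1 {Ω : Type*} [MeasurableSpace Ω] (P : Measure Ω) [IsProbabilityMeasure P]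
    {dz dw : ℕ}
    -- the population variables, the structural function and the error term
    (Y : Ω → ℝ) (Z : Ω → NPIV.Vec dz) (W : Ω → NPIV.Vec dw) (φ : NPIV.Vec dz → ℝ) (U : Ω → ℝ)
    (hmodel : NPIV.IVModel P Y Z W φ U)
    -- the sample
    (Ys : ℕ → Ω → ℝ) (Zs : ℕ → Ω → NPIV.Vec dz) (Ws : ℕ → Ω → NPIV.Vec dw)
    (hsample : NPIV.IsIIDSample P Y Z W Ys Zs Ws)
    -- densities, basis functions, weights
    (pW ν : NPIV.Vec dw → ℝ) (f : ℕ → NPIV.Vec dw → ℝ) (τ : ℕ → ℝ)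
    (hsetup : NPIV.BasisSetup P W pW ν f)
    (hA1 : NPIV.BasisDensityBounds P W pW ν f)
    (hA2 : NPIV.CondFourthMomentBound P W U)
    (hA3 : NPIV.NonsingularCondOp P Z W)
    (hA4 : NPIV.IsWeightSequence τ)
    -- the truncation sequence
    (m : ℕ → ℕ)
    (hm_frob : Tendsto (fun n => NPIV.covFrobenius P W U f τ (m n)) atTop atTop)
    (hm_rate : (fun n => (∑ j ∈ Finset.range (m n), τ j) ^ 3) =o[atTop] (fun n : ℕ => (n : ℝ)))
    -- the null hypothesis
    (φ₀ : NPIV.Vec dz → ℝ) (hH0 : φ =ᵐ[P.map Z] φ₀) :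
    TendstoInDistribution
      (fun (n : ℕ) (ω : Ω) =>
        (√2 * NPIV.covFrobenius P W U f τ (m n))⁻¹ *
          ((n : ℝ) * NPIV.testStat Ys Zs Ws φ₀ f τ n (m n) ω - NPIV.covTrace P W U f τ (m n)))
      atTop (id : ℝ → ℝ) (fun _ => P) (gaussianReal 0 1) := by
  obtain ⟨C, K, hb⟩ := NPIV.exists_scoreBounds hmodel hsetup hA1 hA2
  have hτ := hA4.pos
  have hiid := fun n => NPIV.isCentredIID_score hmodel hsample
    (NPIV.aemeasurable_basis hsetup hA1) hb hτ hH0 (m n)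
  have hfrob0 : ∀ n, 0 ≤ NPIV.covFrobenius P W U f τ (m n) := fun n => Real.sqrt_nonneg _
  -- the fourth moment is `O(t²)` with `t = ∑ τ_j`, and `t² ≤ t³ = o(n)` once `t ≥ τ₁ = 1`
  have hrate : Tendsto (fun n : ℕ =>
      (∫ x, ‖x‖ ^ 4 ∂(NPIV.ScoreBounds.scoreLaw P W U f τ (m n))) / n) atTop (𝓝 0) := by
    have h3 := hm_rate.tendsto_div_nhds_zero.const_mul K
    rw [mul_zero] at h3
    refine squeeze_zero' (Eventually.of_forall fun n =>
      div_nonneg (MeasureTheory.integral_nonneg fun x => by positivity) (by positivity)) ?_ h3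
    filter_upwards [hm_frob.eventually_gt_atTop 0] with n hn
    have hm0 : m n ≠ 0 := by
      intro h0
      rw [h0, NPIV.covFrobenius] at hn
      simp at hn
    have ht1 : 1 ≤ ∑ j ∈ Finset.range (m n), τ j := by
      rw [← hA4.first]
      exact Finset.single_le_sum (f := τ) (fun j _ => (hτ j).le)
        (Finset.mem_range.2 (Nat.pos_of_ne_zero hm0))
    have h4 := hb.integral_norm_pow_four_scoreLaw_le hτ (m := m n)
    have hK : 0 ≤ K := (MeasureTheory.integral_nonneg fun ω => by positivity).trans (hb.four_le 0)
    rw [← mul_div_assoc]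
    refine div_le_div_of_nonneg_right (h4.trans ?_) (by positivity)
    exact mul_le_mul_of_nonneg_left (pow_le_pow_right₀ ht1 (by norm_num)) hK
  refine NPIV.tendstoInDistribution_norm_partialSum_sq hiid hb.C_nonneg
    (fun n a => hb.covQuad_scoreLaw_le hA4 hsetup.basis a)
    (fun n => hb.integral_covQuad_scoreLaw hτ) ?_ hrate ?_ ?_
  · exact (tendsto_pow_atTop two_ne_zero).comp hm_frob
  · exact fun n => (((NPIV.aemeasurable_testStat hτ φ₀ n (m n) (hiid n)).const_mul _).sub_const
      _).const_mul _
  · filter_upwards [eventually_gt_atTop 0] with n hn ω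
    rw [Real.sqrt_sq (hfrob0 n), hb.integral_norm_sq_scoreLaw hτ, NPIV.mul_testStat_eq hτ φ₀ hn]
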